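/- Consider the following market. A monopolist discounts at rate $r>0$ and sells a safe product (flow utility $s$) or a risky product, whose state is good or bad. In the good state the risky product yields a lump sum $z$ at arrival rate $\lambda>0$, in the bad state nothing; put $g=\lambda z$ and assume $g>s>0$. Buyers arrive continuously, with i.i.d. reporting costs whose distribution function $H$ has a continuous positive density $h$ on $[0,\bar c]$, where $\bar c>(\frac{\lambda}{r}+1)(g-s)$; assume that $\beta(x)=x+H(x)/h(x)$ is continuously differentiable with $\beta'>0$ on $(0,\bar c)$. At each moment the seller chooses which arm to promote and a bonus $b\in[0,\bar c]$; buyers with cost at most $b$ buy the risky product and report, the others buy the promoted product without reporting, all at fair prices. Thus at belief $\alpha$ (the probability of the good state) the profit flow is $\lambda\alpha z-H(b)b$ if the risky arm is promoted and $H(b)(\lambda\alpha z-b)+(1-H(b))s$ if the safe arm is promoted. Good news is reported at rate $\lambda\alpha H(b)$ and is then worth $\lambda z/r$; in its absence the belief follows Bayes' rule, $\dot\alpha=-\lambda\alpha(1-\alpha)H(b)$. The strategies are called Full Coverage (risky arm promoted, $0<b<\bar c$), Non Bonus (risky arm promoted, $b=0$), Partial Coverage (safe arm promoted, $0<b<\bar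 c$) and Safe Arm (safe arm promoted, $b=0$). Let $\Pi(\alpha)$ be the maximal expected discounted lifetime profit of the seller at belief $\alpha$. Then there are cutoffs $0<\alpha_{SA}^{PC}<\alpha_{PC}^{FC}<\alpha_{FC}^{NB}<1$ with $$\alpha_{SA}^{PC}=\frac{sr}{\lambda(g-s)+rg},\qquad \alpha_{PC}^{FC}=\frac{s}{\lambda z},$$ and $\alpha_{FC}^{NB}$ the smallest solution $x\in(0,1)$ of $\Pi(x)=xz\lambda/r$, such that the following holds. (a) $\Pi$ is continuously differentiable on $(0,1)$, in particular its branches are pasted smoothly at the three cutoffs, and on $(0,1)$ it satisfies the Bellman equation $$r\Pi(\alpha)=\max\Big\{\pi+H(b)\Big[\frac{\alpha\lambda^2z}{r}-\alpha\lambda\Pi(\alpha)+(\alpha^2-\alpha)\lambda\Pi'(\alpha)\Big]\Big\},$$ the maximum being over the promoted arm and $b\in[0,\bar c]$, with $\pi$ the corresponding profit flow. Moreover $\Pi=s/r$ on $(0,\alpha_{SA}^{PC}]$; on $[\alpha_{SA}^{PC},\alpha_{PC}^{FC}]$ the equation holds with the maximum restricted to promoting the safe arm; on $[\alpha_{PC}^{FC},\alpha_{FC}^{NB}]$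 it holds with the maximum restricted to promoting the risky arm; and $\Pi(\alpha)=\alpha z\lambda/r$ on $[\alpha_{FC}^{NB},1)$. (b) Every maximizer of the Bellman equation at $\alpha$ is Safe Arm if $0<\alpha<\alpha_{SA}^{PC}$, Partial Coverage if $\alpha_{SA}^{PC}<\alpha<\alpha_{PC}^{FC}$, Full Coverage if $\alpha_{PC}^{FC}<\alpha<\alpha_{FC}^{NB}$, and Non Bonus if $\alpha_{FC}^{NB}<\alpha<1$. Some policy depending only on the belief and selecting such maximizers attains the maximal lifetime profit from every prior in $(0,1)$, and every optimal plan uses, at almost every time before good news is reported, the strategy so prescribed at the current belief. -/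

import Mathlib

open Set MeasureTheory

noncomputable section

/-- Primitives of the exponential-bandit market with costly reporting: discount rate `r`, arrival
rate `lam` of the lump sum `z` in the good state, flow utility `s` of the safe arm, and the density
`h` of the reporting cost on `[0, cbar]`. -/
structure Market where
  r : ℝ
  lam : ℝ
  z : ℝ
  s : ℝ
  cbar : ℝ
  h : ℝ → ℝ

/-- The product sold to buyers who do not report. -/
inductive Arm where
  | risky
  | safe

/-- A stage action of the seller: the promoted arm and the (normalized) reporting bonus. -/
structure StageAction where
  arm : Arm
  bonus : ℝ

namespace Market

/-- Flow utility of the risky arm when the state is known to be good. -/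
def g (M : Market) : ℝ := M.lam * M.z

/-- Distribution function of the reporting cost (used on `[0, cbar]` only).  A buyer reports iff his
cost is at most the bonus, so `H b` is also the probability of a report under the bonus `b`. -/
def H (M : Market) (x : ℝ) : ℝ := ∫ t in (0 : ℝ)..x, M.h t

/-- The virtual cost. -/
def beta (M : Market) (x : ℝ) : ℝ := x + M.H x / M.h x

/-- The standing assumptions of the model. -/
structure Standing (M : Market) : Prop where
  r_pos : 0 < M.r
  lam_pos : 0 < M.lam
  s_pos : 0 < M.s
  s_lt_g : M.s < M.g
  cbar_large : (M.lam / M.r + 1) * (M.g - M.s) < M.cbar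
  h_continuous : ContinuousOn M.h (Icc 0 M.cbar)
  h_pos : ∀ x ∈ Icc 0 M.cbar, 0 < M.h x
  h_total : M.H M.cbar = 1
  beta_contDiff : ContDiffOn ℝ 1 M.beta (Ioo 0 M.cbar)
  beta_deriv_pos : ∀ x ∈ Ioo 0 M.cbar, 0 < deriv M.beta x

def Feasible (M : Market) (a : StageAction) : Prop := a.bonus ∈ Icc 0 M.cbar

/-! The four strategies. -/

def IsSafeArm (_M : Market) (a : StageAction) : Prop := a.arm = Arm.safe ∧ a.bonus = 0

def IsPartialCoverage (M : Market) (a : StageAction) : Prop :=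
  a.arm = Arm.safe ∧ 0 < a.bonus ∧ a.bonus < M.cbar

def IsFullCoverage (M : Market) (a : StageAction) : Prop :=
  a.arm = Arm.risky ∧ 0 < a.bonus ∧ a.bonus < M.cbar

def IsNonBonus (_M : Market) (a : StageAction) : Prop := a.arm = Arm.risky ∧ a.bonus = 0

/-- Expected profit flow at belief `α`.  If the risky arm is promoted, every buyer buys it at its
fair price; if the safe arm is promoted, only the reporting buyers buy the risky arm. -/
def flow (M : Market) (α : ℝ) (a : StageAction) : ℝ :=
  match a.arm with
  | Arm.risky => M.lam * α * M.z - M.H a.bonus * a.bonus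
  | Arm.safe => M.H a.bonus * (M.lam * α * M.z - a.bonus) + (1 - M.H a.bonus) * M.s

/-- A plan: the action `act t` is used at time `t ≥ 0` as long as no good news has been reported.
(Until then the public belief moves deterministically, so this covers every path generated by a
policy depending on the belief; after good news the seller sells the risky arm forever.) -/
structure Plan (M : Market) where
  act : ℝ → StageAction
  arm_measurable : MeasurableSet {t | (act t).arm = Arm.risky}
  bonus_measurable : Measurable fun t => (act t).bonus
  feasible : ∀ t, M.Feasible (act t)

variable {M : Market}

/-- Cumulated amount of reported experimentation up to time `t`. -/
def Plan.reports (P : M.Plan) (t : ℝ) : ℝ := ∫ u in (0 : ℝ)..t, M.H (P.act u).bonus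

/-- Probability, with prior `α₀`, that no good news has been reported up to time `t`. -/
def Plan.noNews (P : M.Plan) (α₀ t : ℝ) : ℝ := α₀ * Real.exp (-M.lam * P.reports t) + (1 - α₀)

/-- Posterior (Bayes) belief in the good state at time `t` if no good news has been reported. -/
def Plan.belief (P : M.Plan) (α₀ t : ℝ) : ℝ :=
  α₀ * Real.exp (-M.lam * P.reports t) / P.noNews α₀ t

/-- Expected discounted lifetime profit of a plan at prior `α₀`: good news is reported at rate
`H(b) α λ`, and is then worth `λ z / r`. -/
def Plan.profit (P : M.Plan) (α₀ : ℝ) : ℝ :=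
  ∫ t in Ioi (0 : ℝ), Real.exp (-M.r * t) * P.noNews α₀ t *
    (M.flow (P.belief α₀ t) (P.act t) +
      M.H (P.act t).bonus * (P.belief α₀ t * M.lam) * (M.lam * M.z / M.r))

/-- The plan maximizes the lifetime profit at prior `α₀` among all plans. -/
def Plan.IsOptimal (P : M.Plan) (α₀ : ℝ) : Prop := ∀ Q : M.Plan, Q.profit α₀ ≤ P.profit α₀

variable (M)

/-- The value function of the optimally switching monopolist. -/
def value (α : ℝ) : ℝ := ⨆ P : M.Plan, P.profit α

/-- The right-hand side of the Bellman equation for the candidate value function `W`. -/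
def bellman (W : ℝ → ℝ) (α : ℝ) (a : StageAction) : ℝ :=
  M.flow α a + M.H a.bonus * (α * M.lam ^ 2 * M.z / M.r) - M.H a.bonus * α * M.lam * W α
    + M.H a.bonus * (α ^ 2 - α) * M.lam * deriv W α

/-- `a` attains the maximum in the Bellman equation at belief `α`. -/
def IsBellmanOptimal (W : ℝ → ℝ) (α : ℝ) (a : StageAction) : Prop :=
  M.Feasible a ∧ ∀ a', M.Feasible a' → M.bellman W α a' ≤ M.bellman W α a

/-- The Bellman equation `r W(α) = max_{(ℓ, b)} …`, maximum attained. -/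
def BellmanEq (W : ℝ → ℝ) (α : ℝ) : Prop :=
  IsGreatest (M.bellman W α '' {a | M.Feasible a}) (M.r * W α)

/-- The Bellman equation when only the given arm may be promoted: for `Arm.risky` the
Full Coverage ODE, for `Arm.safe` the Partial Coverage ODE. -/
def ArmEq (ℓ : Arm) (W : ℝ → ℝ) (α : ℝ) : Prop :=
  IsGreatest ((fun b => M.bellman W α ⟨ℓ, b⟩) '' Icc 0 M.cbar) (M.r * W α)

/-- The action is of the type that the cutoff rule prescribes at belief `α`. -/
def Prescribed (αSP αPF αFN α : ℝ) (a : StageAction) : Prop :=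
  (α ∈ Ioo 0 αSP → M.IsSafeArm a) ∧
  (α ∈ Ioo αSP αPF → M.IsPartialCoverage a) ∧
  (α ∈ Ioo αPF αFN → M.IsFullCoverage a) ∧
  (α ∈ Ioo αFN 1 → M.IsNonBonus a)

end Market

end

/-! Write y for the value of a report net of the loss from not selling the better arm, and let `phi
y` be the maximum of H(b)(y - b). The right-hand side of the Bellman equation splits as max(gα, s) +
H(b)(y - b) minus the nonnegative term (1 - H(b)) `armLoss` (`Market.bellman_eq`). Hence the
equation reads rW = max(gα, s) + phi(y): the arm is chosen myopically and the bonus depends on y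
alone. Signs of y and of gα - s then identify the four strategies.

Since `phi` is strictly increasing on the nonnegative axis, the equation can be solved for W' and
becomes a scalar ODE W' = `field`. It is singular at belief one, and the inverse of `phi` need not
be Lipschitz at zero, because `phi` is at most quadratic there. Two features rescue it. The field is
antitone in the value, so solutions of regularized equations converge uniformly
(`exists_solution_of_antitone`) and comparison with barriers is easy (`le_barrier_of_deriv_nonpos`).
And the quadratic bound on `phi` makes the square root of rW - gα fall at rate at least k/(1 - α),
so W meets the line gα/r strictly before belief one (`Market.Standing.exists_truncation`). The field
can therefore be truncated at 1 - δ without changing the solution that matters. Beyond the meeting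
point W stays on the line, and its slope g/r is the value of the field there, so pasting is smooth
without further work. The resulting function is an `IsCandidate`.

Verification identifies W with the value. Along any plan the profit equals W(α₀) minus the integral
of the shortfall in the Bellman equation (`IsCandidate.profit_eq`), which is nonnegative. So W is an
upper bound, and a plan attaining it maximizes the Bellman expression at almost every time. For
attainment the maximizing policy must generate a plan: the accumulated reports solve an autonomous
ODE whose right-hand side is merely continuous, by continuity of the best bonus, and nonnegative;
`exists_solution_of_autonomous` solves it. Strict monotonicity of β enters only in this continuity;
the lower bound on the largest cost keeps the best bonus interior. -/

open Filter Topology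

/-! ### Scalar differential equations without a Lipschitz condition -/

/-- A function that does not increase while it is above a monotone barrier stays below it. -/
theorem le_barrier_of_deriv_nonpos {f f' u : ℝ → ℝ} {a b : ℝ}
    (hf : ContinuousOn f (Icc a b)) (hu : ContinuousOn u (Icc a b)) (hum : MonotoneOn u (Icc a b))
    (hd : ∀ x ∈ Ioo a b, HasDerivAt f (f' x) x) (ha : f a ≤ u a)
    (hneg : ∀ x ∈ Ioo a b, u x < f x → f' x ≤ 0) : ∀ x ∈ Icc a b, f x ≤ u x := by
  intro x₁ hx₁
  by_contra! hlt
  have hsub : Icc a x₁ ⊆ Icc a b := Icc_subset_Icc_right hx₁.2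
  -- Take the last point before x₁ at which f is below the barrier. From there to x₁ the function is
  -- above it, hence antitone, while the barrier does not fall.
  set S : Set ℝ := {x ∈ Icc a x₁ | f x ≤ u x} with hS
  have hSc : IsCompact S :=
    isCompact_Icc.of_isClosed_subset
      (isClosed_Icc.isClosed_le (hf.mono hsub) (hu.mono hsub)) (sep_subset _ _)
  have hSne : S.Nonempty := ⟨a, ⟨le_rfl, hx₁.1⟩, ha⟩
  obtain ⟨⟨h₀a, h₀x⟩, h₀⟩ := hSc.sSup_mem hSne
  set x₀ := sSup S
  have habove : ∀ x ∈ Ioc x₀ x₁, u x < f x := by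
    intro x hx
    by_contra! h
    exact absurd (le_csSup hSc.bddAbove (show x ∈ S from ⟨⟨h₀a.trans hx.1.le, hx.2⟩, h⟩))
      (not_le.2 hx.1)
  have hsub' : Icc x₀ x₁ ⊆ Icc a b := Icc_subset_Icc h₀a hx₁.2
  have hanti : AntitoneOn f (Icc x₀ x₁) := by
    refine antitoneOn_of_hasDerivWithinAt_nonpos (f' := f') (convex_Icc _ _) (hf.mono hsub')
      (fun x hx => ?_) (fun x hx => ?_) <;> rw [interior_Icc] at hx
    · exact (hd x ⟨h₀a.trans_lt hx.1, hx.2.trans_le hx₁.2⟩).hasDerivWithinAt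
    · exact hneg x ⟨h₀a.trans_lt hx.1, hx.2.trans_le hx₁.2⟩ (habove x ⟨hx.1, hx.2.le⟩)
  have h1 := hanti (left_mem_Icc.2 h₀x) (right_mem_Icc.2 h₀x) h₀x
  have h2 := hum ⟨h₀a, h₀x.trans hx₁.2⟩ hx₁ h₀x
  linarith

/-- Global solvability of a scalar ODE with a bounded Lipschitz right-hand side. -/
theorem exists_solution_of_lipschitz {F : ℝ → ℝ → ℝ} {K : NNReal} {C : ℝ}
    (hcont : Continuous (Function.uncurry F)) (hlip : ∀ t, LipschitzWith K (F t))
    (hbdd : ∀ t x, |F t x| ≤ C) (x₀ : ℝ) :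
    ∃ E : ℝ → ℝ, E 0 = x₀ ∧ ∀ t ∈ Icc (0 : ℝ) 1, HasDerivWithinAt E (F t (E t)) (Icc 0 1) t := by
  have hC : 0 ≤ C := (abs_nonneg _).trans (hbdd 0 0)
  have h0 : (0 : ℝ) ∈ Icc (0 : ℝ) 1 := by simp
  have hpl : IsPicardLindelof F (⟨0, h0⟩ : Icc (0 : ℝ) 1) x₀ ⟨C, hC⟩ 0 ⟨C, hC⟩ K :=
    { lipschitzOnWith := fun t _ => (hlip t).lipschitzOnWith
      continuousOn := fun x _ => by
        have : Continuous fun t => F t x := hcont.comp (by fun_prop : Continuous fun t => (t, x))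
        exact this.continuousOn
      norm_le := fun t _ x _ => hbdd t x
      mul_max_le := by simp }
  exact hpl.exists_eq_forall_mem_Icc_hasDerivWithinAt₀

/-- Solvability of a scalar ODE whose right-hand side is decreasing in the unknown and a uniform
limit of bounded Lipschitz decreasing right-hand sides. -/
theorem exists_solution_of_antitone {F : ℕ → ℝ → ℝ → ℝ} {f : ℝ → ℝ → ℝ} {C : ℝ} {δ : ℕ → ℝ}
    (hcont : ∀ n, Continuous (Function.uncurry (F n)))
    (hlip : ∀ n, ∃ K : NNReal, ∀ t, LipschitzWith K (F n t))
    (hanti : ∀ n t, Antitone (F n t)) (hbdd : ∀ n t x, |F n t x| ≤ C)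
    (hclose : ∀ n t x, |F n t x - f t x| ≤ δ n) (hδ : Tendsto δ atTop (𝓝 0)) (x₀ : ℝ) :
    ∃ E : ℝ → ℝ, E 0 = x₀ ∧ ContinuousOn E (Icc 0 1) ∧
      ∀ t ∈ Ioo (0 : ℝ) 1, HasDerivAt E (f t (E t)) t := by
  have hδ0 : ∀ n, 0 ≤ δ n := fun n => (abs_nonneg _).trans (hclose n 0 0)
  have hex : ∀ n, ∃ E : ℝ → ℝ, E 0 = x₀ ∧
      ∀ t ∈ Icc (0 : ℝ) 1, HasDerivWithinAt E (F n t (E t)) (Icc 0 1) t := by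
    intro n
    obtain ⟨K, hK⟩ := hlip n
    exact exists_solution_of_lipschitz (hcont n) hK (hbdd n) x₀
  choose E hE0 hE using hex
  have hEc : ∀ n, ContinuousOn (E n) (Icc 0 1) := fun n => HasDerivWithinAt.continuousOn (hE n)
  have hEd : ∀ n, ∀ t ∈ Ioo (0 : ℝ) 1, HasDerivAt (E n) (F n t (E n t)) t := fun n t ht =>
    (hE n t (Ioo_subset_Icc_self ht)).hasDerivAt (Icc_mem_nhds ht.1 ht.2)
  -- Where E n exceeds E m, monotonicity gives F n (E n) ≤ F n (E m), which differs from F m (E m)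
  -- by at most δ n + δ m. The gap thus grows at most linearly, with no Gronwall factor; the
  -- Lipschitz constants may blow up with n.
  have hdiff : ∀ n m, ∀ t ∈ Icc (0 : ℝ) 1, E n t - E m t ≤ δ n + δ m := by
    intro n m t ht
    have := le_barrier_of_deriv_nonpos (a := 0) (b := 1) (u := fun _ => 0)
      (f := fun t => E n t - E m t - (δ n + δ m) * t)
      (f' := fun t => F n t (E n t) - F m t (E m t) - (δ n + δ m) * 1)
      (((hEc n).sub (hEc m)).sub (by fun_prop)) continuousOn_const (fun _ _ _ _ _ => le_rfl)
      (fun x hx => ((hEd n x hx).sub (hEd m x hx)).sub ((hasDerivAt_id x).const_mul _))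
      (by simp [hE0]) (fun x hx h => by
        have h1 : E m x ≤ E n x := by
          have : 0 ≤ (δ n + δ m) * x := mul_nonneg (add_nonneg (hδ0 n) (hδ0 m)) hx.1.le
          linarith
        have h2 := hanti n x h1
        have h3 := abs_le.1 (hclose n x (E m x))
        have h4 := abs_le.1 (hclose m x (E m x))
        linarith [h3.2, h4.1]) t ht
    have h2 : (δ n + δ m) * t ≤ δ n + δ m :=
      mul_le_of_le_one_right (add_nonneg (hδ0 n) (hδ0 m)) ht.2
    linarith
  have hdiff' : ∀ n m, ∀ t ∈ Icc (0 : ℝ) 1, |E n t - E m t| ≤ δ n + δ m := fun n m t ht =>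
    abs_le.2 ⟨by linarith [hdiff m n t ht], hdiff n m t ht⟩
  have hlim : ∀ t, ∃ l, t ∈ Icc (0 : ℝ) 1 → Tendsto (fun n => E n t) atTop (𝓝 l) := by
    intro t
    by_cases ht : t ∈ Icc (0 : ℝ) 1
    · have hc : CauchySeq fun n => E n t := by
        refine Metric.cauchySeq_iff'.2 fun ε hε => ?_
        obtain ⟨N, hN⟩ := eventually_atTop.1 (hδ.eventually (gt_mem_nhds (half_pos hε)))
        refine ⟨N, fun n hn => (hdiff' n N t ht).trans_lt ?_⟩
        linarith [hN n hn, hN N le_rfl]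
      obtain ⟨l, hl⟩ := cauchySeq_tendsto_of_complete hc
      exact ⟨l, fun _ => hl⟩
    · exact ⟨0, fun h => absurd h ht⟩
  choose e he using hlim
  have hunif : ∀ n, ∀ t ∈ Icc (0 : ℝ) 1, |E n t - e t| ≤ δ n := by
    intro n t ht
    have h1 : Tendsto (fun m => |E n t - E m t|) atTop (𝓝 |E n t - e t|) :=
      (tendsto_const_nhds.sub (he t ht)).abs
    have h2 : Tendsto (fun m => δ n + δ m) atTop (𝓝 (δ n + 0)) := tendsto_const_nhds.add hδ
    simpa using le_of_tendsto_of_tendsto' h1 h2 (fun m => hdiff' n m t ht)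
  have hec : ContinuousOn e (Icc 0 1) := by
    refine TendstoUniformlyOn.continuousOn (F := E) (p := atTop) ?_ (Frequently.of_forall hEc)
    rw [Metric.tendstoUniformlyOn_iff]
    intro ε hε
    filter_upwards [hδ.eventually (gt_mem_nhds hε)] with n hn t ht
    rw [Real.dist_eq, abs_sub_comm]
    exact (hunif n t ht).trans_lt hn
  have hfc : Continuous (Function.uncurry f) := by
    refine TendstoUniformly.continuous (F := fun n => Function.uncurry (F n)) (p := atTop) ?_
      (Frequently.of_forall hcont)
    rw [Metric.tendstoUniformly_iff]
    intro ε hε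
    filter_upwards [hδ.eventually (gt_mem_nhds hε)] with n hn t
    rw [Real.dist_eq, abs_sub_comm]
    exact (hclose n t.1 t.2).trans_lt hn
  have hint : ∀ t ∈ Icc (0 : ℝ) 1, e t = x₀ + ∫ s in (0 : ℝ)..t, f s (e s) := by
    intro t ht
    have h1 : ∀ n, E n t = x₀ + ∫ s in (0 : ℝ)..t, F n s (E n s) := by
      intro n
      have hsub : uIcc 0 t ⊆ Icc (0 : ℝ) 1 := by
        rw [uIcc_of_le ht.1]; exact Icc_subset_Icc_right ht.2
      have := ODE.picard_eq_of_hasDerivAt (f := F n) (α := E n) (t₀ := 0) (t := t) (u := univ)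
        (hcont n).continuousOn (fun s hs => (hE n s (hsub hs)).mono hsub) (mapsTo_univ _ _)
      rw [ODE.picard_apply, hE0] at this
      exact this.symm
    have h2 : Tendsto (fun n => ∫ s in (0 : ℝ)..t, F n s (E n s)) atTop
        (𝓝 (∫ s in (0 : ℝ)..t, f s (e s))) := by
      have hsub : uIoc 0 t ⊆ Icc (0 : ℝ) 1 := by
        rw [uIoc_of_le ht.1]; exact fun s hs => ⟨hs.1.le, hs.2.trans ht.2⟩
      refine intervalIntegral.tendsto_integral_filter_of_dominated_convergence (fun _ => C)
        (Eventually.of_forall fun n => ?_) (Eventually.of_forall fun n => ?_)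
        intervalIntegrable_const ?_
      · have : ContinuousOn (fun s => F n s (E n s)) (Icc 0 1) :=
          (hcont n).comp_continuousOn (continuousOn_id.prodMk (hEc n))
        exact (this.aestronglyMeasurable measurableSet_Icc).mono_measure
          (Measure.restrict_mono hsub le_rfl)
      · exact Eventually.of_forall fun s _ => hbdd n s _
      · refine Eventually.of_forall fun s hs => ?_
        have h3 : Tendsto (fun n => f s (E n s)) atTop (𝓝 (f s (e s))) := by
          have : Continuous fun x => f s x := hfc.comp (by fun_prop : Continuous fun x => (s, x))
          exact (this.tendsto _).comp (he s (hsub hs))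
        have h4 : Tendsto (fun n => F n s (E n s) - f s (E n s)) atTop (𝓝 0) :=
          squeeze_zero_norm (fun n => hclose n s _) hδ
        simpa using h4.add h3
    exact tendsto_nhds_unique (he t ht) (by simpa only [h1] using h2.const_add x₀)
  refine ⟨e, by simpa using hint 0 (by simp), hec, fun t ht => ?_⟩
  have h1 := ODE.hasDerivWithinAt_picard_Icc (f := f) (α := e) (u := univ) (t₀ := 0) (tmin := 0)
    (tmax := 1) (by simp) hfc.continuousOn hec (fun _ _ => mem_univ _) x₀ (Ioo_subset_Icc_self ht)
  exact (h1.congr (fun s hs => hint s hs)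
    (hint t (Ioo_subset_Icc_self ht))).hasDerivAt (Icc_mem_nhds ht.1 ht.2)

/-- A scalar autonomous ODE with a continuous right-hand side that is positive, bounded and bounded
away from zero can be solved by separation of variables; the solution is the inverse of the
travel time. -/
theorem exists_inverse_travel_time {G : ℝ → ℝ} (hG : Continuous G) {c C : ℝ} (hc : 0 < c)
    (hGc : ∀ x, c ≤ G x) (hGC : ∀ x, G x ≤ C) :
    ∃ R : ℝ → ℝ, (∀ t, ∫ x in (0 : ℝ)..R t, (G x)⁻¹ = t) ∧ R 0 = 0 ∧ Monotone R ∧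
      ∀ t, HasDerivAt R (G (R t)) t := by
  have hpos : ∀ x, 0 < G x := fun x => hc.trans_le (hGc x)
  have hinv : Continuous fun x => (G x)⁻¹ := hG.inv₀ fun x => (hpos x).ne'
  set T : ℝ → ℝ := fun y => ∫ x in (0 : ℝ)..y, (G x)⁻¹ with hT
  have hTd : ∀ y, HasDerivAt T (G y)⁻¹ y := fun y =>
    intervalIntegral.integral_hasDerivAt_right (hinv.intervalIntegrable _ _)
      (hinv.stronglyMeasurableAtFilter _ _) hinv.continuousAt
  have hTc : Continuous T := continuous_iff_continuousAt.2 fun y => (hTd y).continuousAt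
  have hTm : StrictMono T := strictMono_of_hasDerivAt_pos hTd fun y => inv_pos.2 (hpos y)
  have hC : 0 < C := (hpos 0).trans_le (hGC 0)
  -- The speed is at most C, so the travel time grows at least linearly; this makes it onto.
  have hlin : Monotone fun y => T y - C⁻¹ * y := by
    refine monotone_of_deriv_nonneg (fun y => ((hTd y).sub
      ((hasDerivAt_id y).const_mul C⁻¹)).differentiableAt) fun y => ?_
    have := ((hTd y).sub ((hasDerivAt_id y).const_mul C⁻¹)).deriv
    have h2 := inv_anti₀ (hpos y) (hGC y)
    change 0 ≤ deriv (T - fun y => C⁻¹ * id y) y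
    rw [this]
    linarith
  have hT0 : T 0 = 0 := by simp [hT]
  have htop : Tendsto T atTop atTop := by
    refine tendsto_atTop_mono' _ ?_ (tendsto_id.const_mul_atTop (inv_pos.2 hC))
    filter_upwards [eventually_ge_atTop 0] with y hy
    have := hlin hy
    simp only [hT0, mul_zero, sub_zero, id] at this ⊢
    linarith
  have hbot : Tendsto T atBot atBot := by
    refine tendsto_atBot_mono' _ ?_ (tendsto_id.const_mul_atBot (inv_pos.2 hC))
    filter_upwards [eventually_le_atBot 0] with y hy
    have := hlin hy
    simp only [hT0, mul_zero, sub_zero, id] at this ⊢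
    linarith
  have hsurj : Function.Surjective T := hTc.surjective htop hbot
  set e := hTm.orderIsoOfSurjective T hsurj
  have hTe : ∀ t, T (e.symm t) = t := fun t => e.apply_symm_apply t
  refine ⟨e.symm, hTe, hTm.injective (by rw [hTe, hT0]), e.symm.monotone, fun t => ?_⟩
  have := HasDerivAt.of_local_left_inverse (f := T) (g := e.symm) (a := t)
    e.symm.continuous.continuousAt (hTd _) (inv_pos.2 (hpos _)).ne' (Eventually.of_forall hTe)
  simpa using this

/-- A scalar autonomous ODE with a continuous, nonnegative, bounded right-hand side can be solved
for all positive times. -/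
theorem exists_solution_of_autonomous {G : ℝ → ℝ} (hG : Continuous G) (hG0 : ∀ x, 0 ≤ G x)
    {C : ℝ} (hC : ∀ x, G x ≤ C) :
    ∃ R : ℝ → ℝ, Continuous R ∧ ∀ t, 0 ≤ t → R t = ∫ u in (0 : ℝ)..t, G (R u) := by
  set ε : ℕ → ℝ := fun n => 1 / ((n : ℝ) + 1) with hε
  have hεpos : ∀ n, 0 < ε n := fun n => Nat.one_div_pos_of_nat
  have hεle : ∀ n, ε n ≤ 1 := fun n => by
    simpa [hε] using Nat.one_div_le_one_div (α := ℝ) (Nat.zero_le n)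
  have hεanti : Antitone ε := fun n m h => Nat.one_div_le_one_div h
  have hε0 : Tendsto ε atTop (𝓝 0) := tendsto_one_div_add_atTop_nhds_zero_nat
  have hex : ∀ n, ∃ R : ℝ → ℝ, (∀ t, ∫ x in (0 : ℝ)..R t, (G x + ε n)⁻¹ = t) ∧ R 0 = 0 ∧
      Monotone R ∧ ∀ t, HasDerivAt R (G (R t) + ε n) t := fun n =>
    exists_inverse_travel_time (by fun_prop) (hεpos n) (fun x => by linarith [hG0 x])
      (C := C + 1) (fun x => by linarith [hC x, hεle n])
  choose R hRT hR0 hRm hRd using hex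
  have hcont : ∀ n, Continuous fun x => (G x + ε n)⁻¹ := fun n =>
    (hG.add continuous_const).inv₀ fun x => (add_pos_of_nonneg_of_pos (hG0 x) (hεpos n)).ne'
  have hRc : ∀ n, Continuous (R n) := fun n =>
    continuous_iff_continuousAt.2 fun t => (hRd n t).continuousAt
  have hRnn : ∀ n t, 0 ≤ t → 0 ≤ R n t := fun n t ht => hR0 n ▸ hRm n ht
  -- Adding less speed cannot bring the solution further: with the smaller speed the travel time to
  -- R n t is already at least t, and strictly more is needed to pass beyond. Monotone convergence
  -- replaces a compactness argument.
  have hRanti : ∀ t, 0 ≤ t → Antitone fun n => R n t := by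
    intro t ht n m hnm
    by_contra! hlt
    have h1 : ∫ x in (0 : ℝ)..R n t, (G x + ε n)⁻¹ ≤ ∫ x in (0 : ℝ)..R n t, (G x + ε m)⁻¹ :=
      intervalIntegral.integral_mono (hRnn n t ht) ((hcont n).intervalIntegrable _ _)
        ((hcont m).intervalIntegrable _ _) fun x =>
          inv_anti₀ (by linarith [hG0 x, hεpos m]) (by linarith [hεanti hnm])
    have h2 : 0 < ∫ x in R n t..R m t, (G x + ε m)⁻¹ :=
      intervalIntegral.intervalIntegral_pos_of_pos ((hcont m).intervalIntegrable _ _)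
        (fun x => inv_pos.2 (by linarith [hG0 x, hεpos m])) hlt
    have h3 := intervalIntegral.integral_add_adjacent_intervals
      ((hcont m).intervalIntegrable (μ := volume) 0 (R n t))
      ((hcont m).intervalIntegrable (R n t) (R m t))
    rw [hRT] at h1 h3
    linarith
  have hlim : ∀ t, ∃ l, 0 ≤ t → Tendsto (fun n => R n t) atTop (𝓝 l) := fun t => by
    by_cases ht : 0 ≤ t
    · exact ⟨_, fun _ => tendsto_atTop_ciInf (hRanti t ht)
        ⟨0, by rintro _ ⟨n, rfl⟩; exact hRnn n t ht⟩⟩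
    · exact ⟨0, fun h => absurd h ht⟩
  choose L hL using hlim
  have hRlip : ∀ n, LipschitzWith (Real.toNNReal (C + 1)) (R n) := fun n => by
    refine lipschitzWith_of_nnnorm_deriv_le (fun t => (hRd n t).differentiableAt) fun t => ?_
    have h0 := add_nonneg (hG0 (R n t)) (hεpos n).le
    have h1 := add_le_add (hC (R n t)) (hεle n)
    rw [← NNReal.coe_le_coe, coe_nnnorm, Real.coe_toNNReal _ (h0.trans h1), (hRd n t).deriv,
      Real.norm_of_nonneg h0]
    exact h1
  have hLlip : LipschitzOnWith (Real.toNNReal (C + 1)) L (Ici 0) :=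
    LipschitzOnWith.of_dist_le_mul fun s hs t ht =>
      le_of_tendsto ((hL s hs).dist (hL t ht)) (Eventually.of_forall fun n =>
        (hRlip n).dist_le_mul s t)
  refine ⟨fun t => L (max t 0), hLlip.continuousOn.comp_continuous (by fun_prop)
    fun t => mem_Ici.2 (le_max_right _ _), fun t ht => ?_⟩
  have hcongr : ∫ u in (0 : ℝ)..t, G (L (max u 0)) = ∫ u in (0 : ℝ)..t, G (L u) := by
    refine intervalIntegral.integral_congr fun u hu => ?_
    rw [uIcc_of_le ht] at hu
    simp only [max_eq_left hu.1]
  simp only [hcongr, max_eq_left ht]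
  have h1 : ∀ n, R n t = ∫ u in (0 : ℝ)..t, (G (R n u) + ε n) := by
    intro n
    have := intervalIntegral.integral_eq_sub_of_hasDerivAt (a := 0) (b := t)
      (fun u _ => hRd n u) (((hG.comp (hRc n)).add continuous_const).intervalIntegrable _ _)
    rw [this, hR0, sub_zero]
  have h2 : Tendsto (fun n => ∫ u in (0 : ℝ)..t, (G (R n u) + ε n)) atTop
      (𝓝 (∫ u in (0 : ℝ)..t, G (L u))) := by
    refine intervalIntegral.tendsto_integral_filter_of_dominated_convergence (fun _ => C + 1)
      (Eventually.of_forall fun n => ?_) (Eventually.of_forall fun n => ?_)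
      intervalIntegrable_const ?_
    · exact ((hG.comp (hRc n)).add continuous_const).aestronglyMeasurable
    · refine Eventually.of_forall fun u _ => ?_
      rw [Real.norm_eq_abs, abs_of_nonneg (add_nonneg (hG0 _) (hεpos n).le)]
      exact add_le_add (hC _) (hεle n)
    · refine Eventually.of_forall fun u hu => ?_
      rw [uIoc_of_le ht] at hu
      simpa using ((hG.tendsto _).comp (hL u hu.1.le)).add hε0
  exact tendsto_nhds_unique (hL t ht) (by simpa only [← h1] using h2)

namespace Market

variable {M : Market}

theorem Standing.gap_pos (hM : M.Standing) : 0 < M.g - M.s := sub_pos.2 hM.s_lt_g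

theorem Standing.g_pos (hM : M.Standing) : 0 < M.g := hM.s_pos.trans hM.s_lt_g

theorem Standing.cbar_pos (hM : M.Standing) : 0 < M.cbar :=
  lt_trans (mul_pos (add_pos (div_pos hM.lam_pos hM.r_pos) one_pos) hM.gap_pos) hM.cbar_large

/-! ### The distribution function -/

@[simp] theorem H_zero (M : Market) : M.H 0 = 0 := by simp [H]

theorem Standing.h_intervalIntegrable (hM : M.Standing) {x y : ℝ} (hx : x ∈ Icc 0 M.cbar)
    (hy : y ∈ Icc 0 M.cbar) : IntervalIntegrable M.h volume x y :=
  (hM.h_continuous.mono (uIcc_subset_Icc hx hy)).intervalIntegrable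

theorem Standing.H_strictMonoOn (hM : M.Standing) : StrictMonoOn M.H (Icc 0 M.cbar) := by
  intro x hx y hy hxy
  have h0 : (0 : ℝ) ∈ Icc 0 M.cbar := ⟨le_rfl, hM.cbar_pos.le⟩
  have h1 := intervalIntegral.integral_add_adjacent_intervals
    (hM.h_intervalIntegrable h0 hx) (hM.h_intervalIntegrable hx hy)
  have h2 : 0 < ∫ t in x..y, M.h t :=
    intervalIntegral.intervalIntegral_pos_of_pos_on (hM.h_intervalIntegrable hx hy)
      (fun t ht => hM.h_pos t ⟨hx.1.trans ht.1.le, ht.2.le.trans hy.2⟩) hxy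
  unfold H
  linarith

theorem Standing.H_continuousOn (hM : M.Standing) : ContinuousOn M.H (Icc 0 M.cbar) :=
  intervalIntegral.continuousOn_primitive_interval
    (hM.h_continuous.mono (by rw [uIcc_of_le hM.cbar_pos.le])).integrableOn_uIcc |>.mono
      (by rw [uIcc_of_le hM.cbar_pos.le])

theorem Standing.H_hasDerivAt (hM : M.Standing) {x : ℝ} (hx : x ∈ Ioo 0 M.cbar) :
    HasDerivAt M.H (M.h x) x := by
  have hn : Icc 0 M.cbar ∈ 𝓝 x := Icc_mem_nhds hx.1 hx.2
  exact intervalIntegral.integral_hasDerivAt_right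
    (hM.h_intervalIntegrable ⟨le_rfl, hM.cbar_pos.le⟩ (Ioo_subset_Icc_self hx))
    (hM.h_continuous.stronglyMeasurableAtFilter_nhdsWithin measurableSet_Icc x |>.filter_mono
      (by rw [nhdsWithin_eq_nhds.2 hn]))
    (hM.h_continuous.continuousAt hn)

theorem Standing.H_nonneg (hM : M.Standing) {b : ℝ} (hb : b ∈ Icc 0 M.cbar) : 0 ≤ M.H b := by
  simpa using hM.H_strictMonoOn.monotoneOn ⟨le_rfl, hM.cbar_pos.le⟩ hb hb.1

theorem Standing.H_pos (hM : M.Standing) {b : ℝ} (hb : b ∈ Icc 0 M.cbar) (h : 0 < b) :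
    0 < M.H b := by
  simpa using hM.H_strictMonoOn ⟨le_rfl, hM.cbar_pos.le⟩ hb h

theorem Standing.H_le_one (hM : M.Standing) {b : ℝ} (hb : b ∈ Icc 0 M.cbar) : M.H b ≤ 1 := by
  simpa [hM.h_total] using hM.H_strictMonoOn.monotoneOn hb ⟨hM.cbar_pos.le, le_rfl⟩ hb.2

theorem Standing.H_lt_one (hM : M.Standing) {b : ℝ} (hb : b ∈ Icc 0 M.cbar) (h : b < M.cbar) :
    M.H b < 1 := by
  simpa [hM.h_total] using hM.H_strictMonoOn hb ⟨hM.cbar_pos.le, le_rfl⟩ h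

/-- The density is bounded on a compact interval. This linear bound becomes the quadratic bound on
`phi`. -/
theorem Standing.exists_H_le_mul (hM : M.Standing) :
    ∃ C, 0 < C ∧ ∀ b ∈ Icc 0 M.cbar, M.H b ≤ C * b := by
  obtain ⟨C, hC⟩ := isCompact_Icc.exists_bound_of_continuousOn hM.h_continuous
  have h0 : (0 : ℝ) ∈ Icc 0 M.cbar := ⟨le_rfl, hM.cbar_pos.le⟩
  refine ⟨C, (norm_pos_iff.2 (hM.h_pos 0 h0).ne').trans_le (hC 0 h0), fun b hb => ?_⟩
  have := intervalIntegral.norm_integral_le_of_norm_le_const (a := 0) (b := b) (f := M.h) (C := C)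
    fun x hx => hC x (by rw [uIoc_of_le hb.1] at hx; exact ⟨hx.1.le, hx.2.trans hb.2⟩)
  rw [sub_zero, abs_of_nonneg hb.1] at this
  exact (le_abs_self _).trans this

/-! ### The value of a report -/

/-- A bonus maximizing `H b * (y - b)`, the net gain of a seller who values reports at `y`. -/
noncomputable def bestBonus (M : Market) (y : ℝ) : ℝ :=
  open Classical in
  if h : ∃ b ∈ Icc 0 M.cbar, IsMaxOn (fun b => M.H b * (y - b)) (Icc 0 M.cbar) b
  then h.choose else 0

/-- The maximal net gain of a seller who values reports at `y`. -/
noncomputable def phi (M : Market) (y : ℝ) : ℝ := M.H (M.bestBonus y) * (y - M.bestBonus y)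

theorem Standing.bestBonus_spec (hM : M.Standing) (y : ℝ) : M.bestBonus y ∈ Icc 0 M.cbar ∧
    ∀ b ∈ Icc 0 M.cbar, M.H b * (y - b) ≤ M.phi y := by
  have h : ∃ b ∈ Icc 0 M.cbar, IsMaxOn (fun b => M.H b * (y - b)) (Icc 0 M.cbar) b :=
    isCompact_Icc.exists_isMaxOn ⟨0, le_rfl, hM.cbar_pos.le⟩
      (hM.H_continuousOn.mul (by fun_prop))
  have hb : M.bestBonus y = h.choose := by rw [bestBonus, dif_pos h]
  obtain ⟨h1, h2⟩ := h.choose_spec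
  rw [phi, hb]
  exact ⟨h1, fun b hb => h2 hb⟩

theorem Standing.bestBonus_mem (hM : M.Standing) (y : ℝ) : M.bestBonus y ∈ Icc 0 M.cbar :=
  (hM.bestBonus_spec y).1

theorem Standing.le_phi (hM : M.Standing) (y : ℝ) {b : ℝ} (hb : b ∈ Icc 0 M.cbar) :
    M.H b * (y - b) ≤ M.phi y :=
  (hM.bestBonus_spec y).2 b hb

theorem Standing.phi_nonneg (hM : M.Standing) (y : ℝ) : 0 ≤ M.phi y := by
  simpa using hM.le_phi y ⟨le_rfl, hM.cbar_pos.le⟩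

theorem Standing.phi_pos (hM : M.Standing) {y : ℝ} (hy : 0 < y) : 0 < M.phi y := by
  have hm : 0 < min (y / 2) M.cbar := lt_min (half_pos hy) hM.cbar_pos
  have hb : min (y / 2) M.cbar ∈ Icc 0 M.cbar := ⟨hm.le, min_le_right _ _⟩
  refine lt_of_lt_of_le (mul_pos (hM.H_pos hb hm) ?_) (hM.le_phi y hb)
  linarith [min_le_left (y / 2) M.cbar]

/-- Reports that are worth nothing are not paid for. -/
theorem Standing.eq_zero_of_eq_phi (hM : M.Standing) {y b : ℝ} (hy : y ≤ 0)
    (hb : b ∈ Icc 0 M.cbar) (h : M.H b * (y - b) = M.phi y) : b = 0 := by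
  by_contra hne
  have hpos : 0 < b := lt_of_le_of_ne hb.1 (Ne.symm hne)
  have := mul_neg_of_pos_of_neg (hM.H_pos hb hpos) (show y - b < 0 by linarith)
  linarith [hM.phi_nonneg y]

/-- A positive optimum forces both factors H(b) and y - b to be positive. -/
theorem Standing.pos_of_eq_phi (hM : M.Standing) {y b : ℝ} (hy : 0 < y)
    (hb : b ∈ Icc 0 M.cbar) (h : M.H b * (y - b) = M.phi y) : 0 < b ∧ b < y := by
  have hφ := hM.phi_pos hy
  have h1 : M.H b ≠ 0 := by
    intro h0
    rw [h0, zero_mul] at h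
    linarith
  have h2 : 0 < M.H b := lt_of_le_of_ne (hM.H_nonneg hb) h1.symm
  refine ⟨lt_of_le_of_ne hb.1 ?_, ?_⟩
  · rintro rfl
    simp at h1
  · rw [← h] at hφ
    linarith [(mul_pos_iff_of_pos_left h2).1 hφ]

theorem Standing.bestBonus_of_nonpos (hM : M.Standing) {y : ℝ} (hy : y ≤ 0) :
    M.bestBonus y = 0 :=
  hM.eq_zero_of_eq_phi hy (hM.bestBonus_mem y) rfl

theorem Standing.phi_of_nonpos (hM : M.Standing) {y : ℝ} (hy : y ≤ 0) : M.phi y = 0 := by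
  simp [phi, hM.bestBonus_of_nonpos hy]

/-- The bonus that is best at x remains available at y. This envelope inequality supplies the
monotonicity, the Lipschitz bound and the slopes of `phi` without differentiating it. -/
theorem Standing.mul_sub_le_phi_sub (hM : M.Standing) (x y : ℝ) :
    M.H (M.bestBonus x) * (y - x) ≤ M.phi y - M.phi x := by
  have := hM.le_phi y (hM.bestBonus_mem x)
  have h2 : M.phi x = M.H (M.bestBonus x) * (x - M.bestBonus x) := rfl
  linear_combination this + h2

theorem Standing.phi_strictMonoOn (hM : M.Standing) : StrictMonoOn M.phi (Ici 0) := by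
  intro x hx y hy hxy
  rcases eq_or_lt_of_le (show (0 : ℝ) ≤ x from hx) with rfl | hx0
  · rw [hM.phi_of_nonpos le_rfl]
    exact hM.phi_pos hxy
  · have h1 := hM.mul_sub_le_phi_sub x y
    have h2 := mul_pos (hM.H_pos (hM.bestBonus_mem x)
      (hM.pos_of_eq_phi hx0 (hM.bestBonus_mem x) rfl).1) (sub_pos.2 hxy)
    linarith

theorem Standing.phi_sub_le (hM : M.Standing) {x y : ℝ} (hxy : x ≤ y) :
    M.phi y - M.phi x ≤ y - x := by
  have h1 := hM.mul_sub_le_phi_sub y x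
  have h2 := mul_le_of_le_one_left (sub_nonneg.2 hxy) (hM.H_le_one (hM.bestBonus_mem y))
  linarith

theorem Standing.phi_mono (hM : M.Standing) : Monotone M.phi := by
  intro x y hxy
  have h1 := hM.mul_sub_le_phi_sub x y
  have h2 := mul_nonneg (hM.H_nonneg (hM.bestBonus_mem x)) (sub_nonneg.2 hxy)
  linarith

theorem Standing.phi_continuous (hM : M.Standing) : Continuous M.phi := by
  refine (LipschitzWith.of_le_add_mul 1 fun x y => ?_).continuous
  rcases le_total x y with h | h
  · have := hM.phi_mono h
    simp only [NNReal.coe_one, one_mul]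
    linarith [dist_nonneg (x := x) (y := y)]
  · have := hM.phi_sub_le h
    simp only [NNReal.coe_one, one_mul, Real.dist_eq]
    linarith [le_abs_self (x - y)]

/-- Both the bonus and the margin are at most y, and H is at most linear in the bonus. This bound is
what ends experimentation before belief one. -/
theorem Standing.exists_phi_le_sq (hM : M.Standing) :
    ∃ C, 0 < C ∧ ∀ y, 0 ≤ y → M.phi y ≤ C * y ^ 2 := by
  obtain ⟨C, hC, h⟩ := hM.exists_H_le_mul
  refine ⟨C, hC, fun y hy => ?_⟩
  rcases eq_or_lt_of_le hy with rfl | hy0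
  · simp [hM.phi_of_nonpos le_rfl]
  · have hb := hM.bestBonus_mem y
    obtain ⟨h1, h2⟩ := hM.pos_of_eq_phi hy0 hb rfl
    calc M.phi y ≤ (C * M.bestBonus y) * y :=
          mul_le_mul (h _ hb) (by linarith) (by linarith) (mul_nonneg hC.le h1.le)
      _ ≤ (C * y) * y := by gcongr
      _ = C * y ^ 2 := by ring

/-- Adding the envelope inequalities for (x, y) and (y, x) orders the report probabilities, and H is
strictly increasing. -/
theorem Standing.bestBonus_monotone (hM : M.Standing) : Monotone M.bestBonus := by
  intro x y hxy
  rcases eq_or_lt_of_le hxy with rfl | hlt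
  · exact le_rfl
  have h1 := hM.mul_sub_le_phi_sub x y
  have h2 := hM.mul_sub_le_phi_sub y x
  have h3 : M.H (M.bestBonus x) ≤ M.H (M.bestBonus y) := by
    by_contra! h
    nlinarith [sub_pos.2 hlt]
  exact (hM.H_strictMonoOn.le_iff_le (hM.bestBonus_mem x) (hM.bestBonus_mem y)).1 h3

theorem Standing.beta_strictMonoOn (hM : M.Standing) : StrictMonoOn M.beta (Ioo 0 M.cbar) :=
  strictMonoOn_of_deriv_pos (convex_Ioo _ _) hM.beta_contDiff.continuousOn
    (by simpa using hM.beta_deriv_pos)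

/-- The first-order condition of the bonus. -/
theorem Standing.beta_bestBonus (hM : M.Standing) {y : ℝ} (hy : y ∈ Ioo 0 M.cbar) :
    M.bestBonus y ∈ Ioo 0 M.cbar ∧ M.beta (M.bestBonus y) = y := by
  obtain ⟨h1, h2⟩ := hM.pos_of_eq_phi hy.1 (hM.bestBonus_mem y) rfl
  have hmem : M.bestBonus y ∈ Ioo 0 M.cbar := ⟨h1, h2.trans hy.2⟩
  refine ⟨hmem, ?_⟩
  have hmax : IsLocalMax (fun b => M.H b * (y - b)) (M.bestBonus y) := by
    filter_upwards [Icc_mem_nhds hmem.1 hmem.2] with b hb using hM.le_phi y hb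
  have hd : HasDerivAt (fun b => M.H b * (y - b))
      (M.h (M.bestBonus y) * (y - M.bestBonus y) + M.H (M.bestBonus y) * (-1)) (M.bestBonus y) :=
    (hM.H_hasDerivAt hmem).mul ((hasDerivAt_id _).const_sub y)
  have h0 := hmax.hasDerivAt_eq_zero hd
  have hh := hM.h_pos _ (Ioo_subset_Icc_self hmem)
  unfold beta
  field_simp
  linarith

/-- For nonpositive y the bonus is squeezed to zero by 0 ≤ b < y. For positive y the bonus is
monotone, and by the first-order condition its image fills a neighbourhood, since every nearby b is
the best bonus at β(b); hence there are no jumps. -/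
theorem Standing.bestBonus_continuousAt (hM : M.Standing) {y : ℝ} (hy : y < M.cbar) :
    ContinuousAt M.bestBonus y := by
  rcases le_or_gt y 0 with h0 | h0
  · rw [ContinuousAt, hM.bestBonus_of_nonpos h0]
    refine tendsto_order.2 ⟨fun a ha => Eventually.of_forall fun x =>
      ha.trans_le (hM.bestBonus_mem x).1, fun a ha => ?_⟩
    filter_upwards [gt_mem_nhds (h0.trans_lt ha)] with x hx
    rcases le_or_gt x 0 with hx0 | hx0
    · rwa [hM.bestBonus_of_nonpos hx0]
    · exact (hM.pos_of_eq_phi hx0 (hM.bestBonus_mem x) rfl).2.trans hx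
  · obtain ⟨hb, hβ⟩ := hM.beta_bestBonus ⟨h0, hy⟩
    refine continuousAt_of_monotoneOn_of_image_mem_nhds (s := Ioo 0 M.cbar)
      (hM.bestBonus_monotone.monotoneOn _) (Ioo_mem_nhds h0 hy) ?_
    have hc : ContinuousAt M.beta (M.bestBonus y) :=
      hM.beta_contDiff.continuousOn.continuousAt (Ioo_mem_nhds hb.1 hb.2)
    filter_upwards [hc.preimage_mem_nhds (Ioo_mem_nhds (hβ.symm ▸ h0) (hβ.symm ▸ hy)),
      Ioo_mem_nhds hb.1 hb.2] with b hb1 hb2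
    obtain ⟨h3, h4⟩ := hM.beta_bestBonus hb1
    exact ⟨M.beta b, hb1, hM.beta_strictMonoOn.injOn h3 hb2 h4⟩

/-! ### The report value that yields a given net gain -/

/-- The report value in `[0, Y]` at which the maximal net gain is `u`, with `u` clipped to
`[0, phi Y]`. -/
noncomputable def invPhi (M : Market) (Y u : ℝ) : ℝ :=
  Function.invFunOn M.phi (Icc 0 Y) (max 0 (min u (M.phi Y)))

theorem Standing.invPhi_spec (hM : M.Standing) {Y : ℝ} (hY : 0 ≤ Y) (u : ℝ) :
    M.invPhi Y u ∈ Icc 0 Y ∧ M.phi (M.invPhi Y u) = max 0 (min u (M.phi Y)) := by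
  have h : max 0 (min u (M.phi Y)) ∈ M.phi '' Icc 0 Y := by
    refine intermediate_value_Icc hY hM.phi_continuous.continuousOn ⟨?_, ?_⟩
    · rw [hM.phi_of_nonpos le_rfl]
      exact le_max_left _ _
    · exact max_le (hM.phi_nonneg Y) (min_le_right _ _)
  exact ⟨Function.invFunOn_mem h, Function.invFunOn_eq h⟩

theorem Standing.invPhi_monotone (hM : M.Standing) {Y : ℝ} (hY : 0 ≤ Y) :
    Monotone (M.invPhi Y) := by
  intro u v huv
  obtain ⟨h1, h2⟩ := hM.invPhi_spec hY u
  obtain ⟨h3, h4⟩ := hM.invPhi_spec hY v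
  refine (hM.phi_strictMonoOn.le_iff_le h1.1 h3.1).1 ?_
  rw [h2, h4]
  gcongr

theorem Standing.invPhi_of_nonpos (hM : M.Standing) {Y u : ℝ} (hY : 0 ≤ Y) (hu : u ≤ 0) :
    M.invPhi Y u = 0 := by
  obtain ⟨h1, h2⟩ := hM.invPhi_spec hY u
  rw [max_eq_left (min_le_of_left_le hu), ← hM.phi_of_nonpos le_rfl] at h2
  exact hM.phi_strictMonoOn.injOn h1.1 (mem_Ici.2 le_rfl) h2

theorem Standing.phi_invPhi (hM : M.Standing) {Y u : ℝ} (hY : 0 ≤ Y) (hu : u ∈ Icc 0 (M.phi Y)) :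
    M.phi (M.invPhi Y u) = u := by
  rw [(hM.invPhi_spec hY u).2, min_eq_left hu.2, max_eq_right hu.1]

theorem Standing.invPhi_of_phi_le (hM : M.Standing) {Y u : ℝ} (hY : 0 ≤ Y) (hu : M.phi Y ≤ u) :
    M.invPhi Y u = Y := by
  obtain ⟨h1, h2⟩ := hM.invPhi_spec hY u
  rw [min_eq_right hu, max_eq_right (hM.phi_nonneg Y)] at h2
  exact hM.phi_strictMonoOn.injOn h1.1 hY h2

theorem Standing.invPhi_pos (hM : M.Standing) {Y u : ℝ} (hY : 0 < Y) (hu : 0 < u) :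
    0 < M.invPhi Y u := by
  obtain ⟨h1, h2⟩ := hM.invPhi_spec hY.le u
  refine lt_of_le_of_ne h1.1 fun h => ?_
  rw [← h, hM.phi_of_nonpos le_rfl] at h2
  have := lt_max_of_lt_right (a := (0 : ℝ)) (b := 0) (lt_min hu (hM.phi_pos hY))
  linarith

/-- The envelope inequality bounds the slope of `phi` from below by the report probability, which is
at least ε/Y where `phi` is at least ε. Cutting off below ε therefore restores a Lipschitz inverse.
-/
theorem Standing.invPhi_lipschitz (hM : M.Standing) {Y ε : ℝ} (hY : 0 < Y) (hε : 0 < ε)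
    (hεY : ε ≤ M.phi Y) : LipschitzWith (Real.toNNReal (Y / ε)) fun u => M.invPhi Y (max u ε) := by
  refine LipschitzWith.of_le_add_mul _ fun u v => ?_
  rw [Real.coe_toNNReal _ (by positivity)]
  have hmono := hM.invPhi_monotone hY.le
  rcases le_total u v with h | h
  · have h1 := hmono (max_le_max_right ε h)
    have : 0 ≤ Y / ε * dist u v := by positivity
    linarith
  obtain ⟨h1, h2⟩ := hM.invPhi_spec hY.le (max u ε)
  obtain ⟨h3, h4⟩ := hM.invPhi_spec hY.le (max v ε)
  have h5 := hmono (max_le_max_right ε h)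
  set y := M.invPhi Y (max u ε)
  set x := M.invPhi Y (max v ε)
  have h6 := hM.mul_sub_le_phi_sub x y
  have h7 : M.phi y - M.phi x ≤ dist u v := by
    rw [h2, h4, Real.dist_eq]
    calc _ ≤ |max 0 (min (max u ε) (M.phi Y)) - max 0 (min (max v ε) (M.phi Y))| := le_abs_self _
      _ ≤ |min (max u ε) (M.phi Y) - min (max v ε) (M.phi Y)| := by
        simpa using abs_max_sub_max_le_max 0 (min (max u ε) (M.phi Y)) 0 (min (max v ε) (M.phi Y))
      _ ≤ |max u ε - max v ε| := by
        simpa using abs_min_sub_min_le_max (max u ε) (M.phi Y) (max v ε) (M.phi Y)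
      _ ≤ |u - v| := abs_max_sub_max_le_abs _ _ _
  have h8 : ε ≤ M.H (M.bestBonus x) * Y := by
    have e1 : ε ≤ M.phi x := by
      rw [h4]
      exact le_max_of_le_right (le_min (le_max_right _ _) hεY)
    have hb := hM.bestBonus_mem x
    have e2 : M.phi x ≤ M.H (M.bestBonus x) * Y :=
      mul_le_mul_of_nonneg_left (by linarith [h3.2, hb.1]) (hM.H_nonneg hb)
    linarith
  have h9 : ε * (y - x) ≤ Y * dist u v := by
    calc ε * (y - x) ≤ (M.H (M.bestBonus x) * Y) * (y - x) :=
          mul_le_mul_of_nonneg_right h8 (sub_nonneg.2 h5)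
      _ = Y * (M.H (M.bestBonus x) * (y - x)) := by ring
      _ ≤ Y * dist u v := mul_le_mul_of_nonneg_left (h6.trans h7) hY.le
  have : y - x ≤ Y / ε * dist u v := by
    rw [div_mul_eq_mul_div, le_div_iff₀ hε]
    linarith
  linarith

theorem Standing.abs_invPhi_max_sub_le (hM : M.Standing) {Y ε : ℝ} (hY : 0 ≤ Y) (u : ℝ) :
    |M.invPhi Y (max u ε) - M.invPhi Y u| ≤ M.invPhi Y ε := by
  have hmono := hM.invPhi_monotone hY
  rw [abs_of_nonneg (sub_nonneg.2 (hmono (le_max_left u ε)))]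
  rcases le_total u ε with h | h
  · rw [max_eq_right h]
    linarith [(hM.invPhi_spec hY u).1.1]
  · rw [max_eq_left h, sub_self]
    exact (hM.invPhi_spec hY ε).1.1

theorem Standing.tendsto_invPhi (hM : M.Standing) {Y : ℝ} (hY : 0 < Y) {ε : ℕ → ℝ}
    (hε : Tendsto ε atTop (𝓝 0)) : Tendsto (fun n => M.invPhi Y (ε n)) atTop (𝓝 0) := by
  refine tendsto_order.2 ⟨fun a ha => Eventually.of_forall fun n =>
    ha.trans_le (hM.invPhi_spec hY.le _).1.1, fun a ha => ?_⟩
  filter_upwards [hε.eventually (gt_mem_nhds (hM.phi_pos ha))] with n hn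
  obtain ⟨h1, h2⟩ := hM.invPhi_spec hY.le (ε n)
  refine (hM.phi_strictMonoOn.lt_iff_lt h1.1 ha.le).1 ?_
  rw [h2]
  exact max_lt (hM.phi_pos ha) (min_lt_of_left_lt hn)

/-! ### The cutoff beliefs and the bound on the report value -/

variable {M : Market}

/-- The belief at which experimentation starts. -/
noncomputable def cutSP (M : Market) : ℝ := M.s * M.r / (M.lam * (M.g - M.s) + M.r * M.g)

/-- The myopic cutoff belief. -/
noncomputable def cutPF (M : Market) : ℝ := M.s / M.g

/-- The value of a report to a sure seller who only earns the safe profit. -/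
noncomputable def topValue (M : Market) : ℝ := M.lam * (M.g - M.s) / M.r

theorem Standing.cutSP_denom_pos (hM : M.Standing) : 0 < M.lam * (M.g - M.s) + M.r * M.g :=
  add_pos (mul_pos hM.lam_pos hM.gap_pos) (mul_pos hM.r_pos hM.g_pos)

theorem Standing.cutSP_pos (hM : M.Standing) : 0 < M.cutSP :=
  div_pos (mul_pos hM.s_pos hM.r_pos) hM.cutSP_denom_pos

theorem Standing.cutSP_lt_cutPF (hM : M.Standing) : M.cutSP < M.cutPF := by
  unfold cutSP cutPF
  rw [div_lt_div_iff₀ hM.cutSP_denom_pos hM.g_pos]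
  have := mul_pos hM.s_pos (mul_pos hM.lam_pos hM.gap_pos)
  linarith

theorem Standing.cutPF_lt_one (hM : M.Standing) : M.cutPF < 1 :=
  (div_lt_one hM.g_pos).2 hM.s_lt_g

theorem Standing.lt_cutPF_iff (hM : M.Standing) {a : ℝ} : a < M.cutPF ↔ M.g * a < M.s := by
  rw [cutPF, lt_div_iff₀ hM.g_pos, mul_comm]

theorem Standing.cutPF_le_iff (hM : M.Standing) {a : ℝ} : M.cutPF ≤ a ↔ M.s ≤ M.g * a := by
  rw [← not_lt, hM.lt_cutPF_iff, not_lt]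

/-- The report value if the profit is the safe one, negative before and positive after
`cutSP`. -/
theorem Standing.safe_report_value (hM : M.Standing) (a : ℝ) :
    M.lam * a * (M.g / M.r - M.s / M.r) + (M.g * a - M.s) =
      (a - M.cutSP) * ((M.lam * (M.g - M.s) + M.r * M.g) / M.r) := by
  have h1 : M.cutSP * (M.lam * (M.g - M.s) + M.r * M.g) = M.s * M.r :=
    div_mul_cancel₀ _ hM.cutSP_denom_pos.ne'
  have h2 := hM.r_pos.ne'
  field_simp
  linear_combination h1

theorem Standing.topValue_pos (hM : M.Standing) : 0 < M.topValue :=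
  div_pos (mul_pos hM.lam_pos hM.gap_pos) hM.r_pos

theorem Standing.topValue_lt_cbar (hM : M.Standing) : M.topValue < M.cbar := by
  have h1 := hM.cbar_large
  have h2 : (M.lam / M.r + 1) * (M.g - M.s) = M.topValue + (M.g - M.s) := by
    unfold topValue; ring
  linarith [hM.gap_pos]

/-! ### The right-hand side of the differential equation of the value function -/

/-- The slope of the value function at belief `a` and value `x`, where `p` maps the net gain from
reports to the value of a report; `δ` truncates the singularity at belief one and the value is
clipped to `[s / r, g / r]`. -/
noncomputable def field (M : Market) (p : ℝ → ℝ) (δ a x : ℝ) : ℝ :=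
  M.g / M.r - (max (M.s / M.r) (min x (M.g / M.r)) - M.g * a / M.r) / max (1 - a) δ
    + (min (M.g * a - M.s) 0 - p (M.r * x - max (M.g * a) M.s)) / (M.lam * a * max (1 - a) δ)

/-- A higher value makes conclusive news less of a gain and, through the inverse of `phi`, requires
a larger report value; both lower the slope. -/
theorem Standing.field_antitone (hM : M.Standing) {p : ℝ → ℝ} (hp : Monotone p) {δ a : ℝ}
    (hδ : 0 < δ) (ha : 0 < a) : Antitone (M.field p δ a) := by
  intro x y hxy
  have hr := hM.r_pos
  have hl := hM.lam_pos
  have hΔ : 0 < max (1 - a) δ := lt_max_of_lt_right hδ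
  have h1 : M.r * x - max (M.g * a) M.s ≤ M.r * y - max (M.g * a) M.s := by gcongr
  have h2 := hp h1
  unfold field
  gcongr

theorem field_sub_field (p q : ℝ → ℝ) (δ a x : ℝ) : M.field p δ a x - M.field q δ a x =
    (q (M.r * x - max (M.g * a) M.s) - p (M.r * x - max (M.g * a) M.s)) /
      (M.lam * a * max (1 - a) δ) := by
  unfold field; ring

theorem Standing.denom_ge (hM : M.Standing) {δ P a : ℝ} (hδ : 0 < δ) (hP : 0 < P) (ha : P ≤ a) :
    M.lam * P * δ ≤ M.lam * a * max (1 - a) δ := by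
  have hl := hM.lam_pos
  have : δ ≤ max (1 - a) δ := le_max_right _ _
  have ha0 : 0 ≤ M.lam * a := mul_nonneg hl.le (hP.le.trans ha)
  gcongr

theorem Standing.abs_field_sub_field_le (hM : M.Standing) {p q : ℝ → ℝ} {δ P a η : ℝ} (hδ : 0 < δ)
    (hP : 0 < P) (ha : P ≤ a) (h : ∀ u, |p u - q u| ≤ η) (x : ℝ) :
    |M.field p δ a x - M.field q δ a x| ≤ η / (M.lam * P * δ) := by
  have hl := hM.lam_pos
  have hden := hM.denom_ge hδ hP ha
  have hpos : 0 < M.lam * P * δ := by positivity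
  rw [field_sub_field, abs_div, abs_of_pos (hpos.trans_le hden), abs_sub_comm]
  exact div_le_div₀ ((abs_nonneg _).trans (h 0)) (h _) hpos hden

theorem Standing.abs_field_le (hM : M.Standing) {p : ℝ → ℝ} {δ P a Y : ℝ} (hδ : 0 < δ)
    (hP : 0 < P) (ha : P ≤ a) (ha1 : a ≤ 1) (hp : ∀ u, p u ∈ Icc 0 Y) (x : ℝ) :
    |M.field p δ a x| ≤ M.g / M.r + M.g / M.r / δ + (M.s + Y) / (M.lam * P * δ) := by
  have hl := hM.lam_pos
  have hr := hM.r_pos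
  have hs := hM.s_pos
  have hg := hM.g_pos
  have ha0 : 0 < a := hP.trans_le ha
  have hden := hM.denom_ge hδ hP ha
  have hpos : 0 < M.lam * P * δ := by positivity
  have hgr : 0 < M.g / M.r := div_pos hg hr
  have hsg : M.s / M.r ≤ M.g / M.r := by gcongr; exact hM.s_lt_g.le
  have h1 : |(max (M.s / M.r) (min x (M.g / M.r)) - M.g * a / M.r) / max (1 - a) δ| ≤
      M.g / M.r / δ := by
    rw [abs_div, abs_of_pos (lt_max_of_lt_right hδ : 0 < max (1 - a) δ)]
    refine div_le_div₀ hgr.le ?_ hδ (le_max_right _ _)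
    have e1 : 0 ≤ max (M.s / M.r) (min x (M.g / M.r)) := le_max_of_le_left (by positivity)
    have e2 : max (M.s / M.r) (min x (M.g / M.r)) ≤ M.g / M.r := max_le hsg (min_le_right _ _)
    have e3 : 0 ≤ M.g * a / M.r := by positivity
    have e4 : M.g * a / M.r ≤ M.g / M.r := by
      gcongr
      exact mul_le_of_le_one_right hg.le ha1
    exact abs_le.2 ⟨by linarith, by linarith⟩
  have h2 : |(min (M.g * a - M.s) 0 - p (M.r * x - max (M.g * a) M.s)) /
      (M.lam * a * max (1 - a) δ)| ≤ (M.s + Y) / (M.lam * P * δ) := by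
    rw [abs_div, abs_of_pos (hpos.trans_le hden)]
    obtain ⟨e1, e2⟩ := hp (M.r * x - max (M.g * a) M.s)
    refine div_le_div₀ (by linarith) ?_ hpos hden
    have e3 : -M.s ≤ min (M.g * a - M.s) 0 := le_min (by nlinarith) (by linarith)
    have e4 : min (M.g * a - M.s) 0 ≤ 0 := min_le_right _ _
    exact abs_le.2 ⟨by linarith, by linarith⟩
  unfold field
  calc _ ≤ |M.g / M.r| + _ + _ := (abs_add_le _ _).trans (add_le_add_left (abs_sub _ _) _)
    _ ≤ _ := by
      rw [abs_of_pos hgr]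
      gcongr

theorem Standing.field_lipschitz (hM : M.Standing) {p : ℝ → ℝ} {K : NNReal} (hp : LipschitzWith K p)
    {δ P : ℝ} (hδ : 0 < δ) (hP : 0 < P) :
    ∃ L : NNReal, ∀ a, P ≤ a → LipschitzWith L (M.field p δ a) := by
  have hl := hM.lam_pos
  have hr := hM.r_pos
  have hpos : 0 < M.lam * P * δ := by positivity
  refine ⟨Real.toNNReal (1 / δ + K * M.r / (M.lam * P * δ)), fun a ha => ?_⟩
  refine LipschitzWith.of_le_add_mul _ fun x y => ?_
  rw [Real.coe_toNNReal _ (by positivity)]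
  have hden := hM.denom_ge hδ hP ha
  set X := max (M.s / M.r) (min x (M.g / M.r)) with hX
  set X' := max (M.s / M.r) (min y (M.g / M.r)) with hX'
  have h1 : |X - X'| ≤ dist x y := by
    calc |X - X'| ≤ |min x (M.g / M.r) - min y (M.g / M.r)| := by
          simpa using abs_max_sub_max_le_max (M.s / M.r) (min x (M.g / M.r)) (M.s / M.r)
            (min y (M.g / M.r))
      _ ≤ |x - y| := by simpa using abs_min_sub_min_le_max x (M.g / M.r) y (M.g / M.r)
  have h2 : |p (M.r * x - max (M.g * a) M.s) - p (M.r * y - max (M.g * a) M.s)| ≤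
      K * M.r * dist x y := by
    have := hp.dist_le_mul (M.r * x - max (M.g * a) M.s) (M.r * y - max (M.g * a) M.s)
    rw [Real.dist_eq, Real.dist_eq] at this
    have e : M.r * x - max (M.g * a) M.s - (M.r * y - max (M.g * a) M.s) = M.r * (x - y) := by
      ring
    rw [e, abs_mul, abs_of_pos hr] at this
    rw [Real.dist_eq]
    linarith
  have e : M.field p δ a x - M.field p δ a y = (X' - X) / max (1 - a) δ +
      (p (M.r * y - max (M.g * a) M.s) - p (M.r * x - max (M.g * a) M.s)) /
        (M.lam * a * max (1 - a) δ) := by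
    unfold field; ring
  have h3 : (X' - X) / max (1 - a) δ ≤ dist x y / δ :=
    div_le_div₀ dist_nonneg (by linarith [(abs_le.1 h1).1]) hδ (le_max_right _ _)
  have h4 : (p (M.r * y - max (M.g * a) M.s) - p (M.r * x - max (M.g * a) M.s)) /
      (M.lam * a * max (1 - a) δ) ≤ K * M.r * dist x y / (M.lam * P * δ) :=
    div_le_div₀ (by positivity) (by linarith [(abs_le.1 h2).1]) hpos hden
  have h5 : (1 / δ + K * M.r / (M.lam * P * δ)) * dist x y =
      dist x y / δ + K * M.r * dist x y / (M.lam * P * δ) := by ring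
  linarith

theorem Standing.field_continuous (hM : M.Standing) {p : ℝ → ℝ} (hp : Continuous p) {δ P : ℝ}
    (hδ : 0 < δ) (hP : 0 < P) :
    Continuous (Function.uncurry fun t x => M.field p δ (max P (min t 1)) x) := by
  have hl := hM.lam_pos
  have h1 : ∀ a : ℝ, max (1 - a) δ ≠ 0 := fun a =>
    (lt_max_of_lt_right hδ : 0 < max (1 - a) δ).ne'
  have h2 : ∀ t : ℝ, M.lam * max P (min t 1) * max (1 - max P (min t 1)) δ ≠ 0 := fun t =>
    mul_ne_zero (mul_pos hl (lt_max_of_lt_left hP)).ne' (h1 _)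
  unfold field Function.uncurry
  refine ((Continuous.sub continuous_const (Continuous.div (by fun_prop) (by fun_prop)
    fun _ => h1 _)).add (Continuous.div ?_ (by fun_prop) fun _ => h2 _))
  exact (by fun_prop : Continuous _).sub (hp.comp (by fun_prop))

theorem Standing.exists_regularization (hM : M.Standing) {Y : ℝ} (hY : 0 < Y) :
    ∃ ε : ℕ → ℝ, (∀ n, 0 < ε n) ∧ (∀ n, ε n ≤ M.phi Y) ∧ Tendsto ε atTop (𝓝 0) := by
  have hφ := hM.phi_pos hY
  refine ⟨fun n => M.phi Y * (1 / ((n : ℝ) + 1)), fun n => mul_pos hφ Nat.one_div_pos_of_nat,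
    fun n => mul_le_of_le_one_right hφ.le ?_, ?_⟩
  · simpa using Nat.one_div_le_one_div (α := ℝ) (Nat.zero_le n)
  · simpa using (tendsto_one_div_add_atTop_nhds_zero_nat (𝕜 := ℝ)).const_mul (M.phi Y)

/-- The regularized differential equation of the value function has a solution. -/
theorem Standing.exists_field_solution (hM : M.Standing) {δ P Y : ℝ} (hδ : 0 < δ) (hP : 0 < P)
    (hP1 : P ≤ 1) (hY : 0 < Y) (x₀ : ℝ) : ∃ E : ℝ → ℝ, E 0 = x₀ ∧ ContinuousOn E (Icc 0 1) ∧
      ∀ t ∈ Ioo (0 : ℝ) 1, HasDerivAt E (M.field (M.invPhi Y) δ (max P (min t 1)) (E t)) t := by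
  obtain ⟨ε, hεpos, hεle, hε0⟩ := hM.exists_regularization hY
  have hlip := fun n => hM.invPhi_lipschitz hY (hεpos n) (hεle n)
  have hPa : ∀ t : ℝ, P ≤ max P (min t 1) := fun t => le_max_left _ _
  refine exists_solution_of_antitone
    (F := fun n t x => M.field (fun u => M.invPhi Y (max u (ε n))) δ (max P (min t 1)) x)
    (δ := fun n => M.invPhi Y (ε n) / (M.lam * P * δ))
    (C := M.g / M.r + M.g / M.r / δ + (M.s + Y) / (M.lam * P * δ))
    (fun n => hM.field_continuous (hlip n).continuous hδ hP) (fun n => ?_) (fun n t => ?_)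
    (fun n t x => ?_) (fun n t x => ?_) ?_ x₀
  · obtain ⟨L, hL⟩ := hM.field_lipschitz (hlip n) hδ hP
    exact ⟨L, fun t => hL _ (hPa t)⟩
  · exact hM.field_antitone (fun u v h => hM.invPhi_monotone hY.le (max_le_max_right _ h)) hδ
      (hP.trans_le (hPa t))
  · exact hM.abs_field_le hδ hP (hPa t) (max_le hP1 (min_le_right _ _))
      (fun u => (hM.invPhi_spec hY.le _).1) x
  · exact hM.abs_field_sub_field_le hδ hP (hPa t) (fun u => hM.abs_invPhi_max_sub_le hY.le u) x
  · simpa using (hM.tendsto_invPhi hY hε0).div_const (M.lam * P * δ)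

theorem Standing.invPhi_continuous (hM : M.Standing) {Y : ℝ} (hY : 0 < Y) :
    Continuous (M.invPhi Y) := by
  obtain ⟨ε, hεpos, hεle, hε0⟩ := hM.exists_regularization hY
  refine TendstoUniformly.continuous (F := fun n u => M.invPhi Y (max u (ε n))) (p := atTop) ?_
    (Frequently.of_forall fun n => (hM.invPhi_lipschitz hY (hεpos n) (hεle n)).continuous)
  rw [Metric.tendstoUniformly_iff]
  intro η hη
  filter_upwards [(hM.tendsto_invPhi hY hε0).eventually (gt_mem_nhds hη)] with n hn u
  rw [Real.dist_eq, abs_sub_comm]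
  exact (hM.abs_invPhi_max_sub_le hY.le u).trans_lt hn

/-! ### The properties of the value function to be established -/

variable {M : Market}

/-- The value of a report at belief `α` for the value function `W` with derivative `W'`, net of the
loss from not selling the better arm. -/
noncomputable def reportValue (M : Market) (W W' : ℝ → ℝ) (α : ℝ) : ℝ :=
  M.lam * α * (M.g / M.r - W α - (1 - α) * W' α) + min (M.g * α - M.s) 0

/-- `W` has all properties claimed of the value function, with the cutoff `αFN` for the end of
experimentation. -/
structure IsCandidate (M : Market) (W W' : ℝ → ℝ) (αFN : ℝ) : Prop where
  hasDerivAt : ∀ α ∈ Ioo (0 : ℝ) 1, HasDerivAt W (W' α) α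
  deriv_continuousOn : ContinuousOn W' (Ioo 0 1)
  bounded : ∃ C, ∀ α ∈ Ioo (0 : ℝ) 1, |W α| ≤ C ∧ |W' α| ≤ C
  cutPF_lt : M.cutPF < αFN
  lt_one : αFN < 1
  eq_safe : ∀ α ∈ Ioc 0 M.cutSP, W α = M.s / M.r
  eq_risky : ∀ α ∈ Ico αFN 1, W α = M.g * α / M.r
  value_eq : ∀ α ∈ Ioo (0 : ℝ) 1,
    M.r * W α = max (M.g * α) M.s + M.phi (M.reportValue W W' α)
  reportValue_lt : ∀ α ∈ Ioo (0 : ℝ) 1, M.reportValue W W' α < M.cbar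
  reportValue_nonpos_left : ∀ α ∈ Ioo 0 M.cutSP, M.reportValue W W' α ≤ 0
  reportValue_pos : ∀ α ∈ Ioo M.cutSP αFN, 0 < M.reportValue W W' α
  reportValue_nonpos_right : ∀ α ∈ Ico αFN 1, M.reportValue W W' α ≤ 0

/-! ### Signs of the slope field -/

theorem Standing.field_mul (hM : M.Standing) {p : ℝ → ℝ} {δ a : ℝ} (ha : 0 < a)
    (hδ : 0 < δ) (hδa : δ ≤ 1 - a) (x : ℝ) :
    M.lam * a * (1 - a) * M.field p δ a x =
      M.lam * a * (M.g / M.r - max (M.s / M.r) (min x (M.g / M.r))) + min (M.g * a - M.s) 0 -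
        p (M.r * x - max (M.g * a) M.s) := by
  have h1 := hM.lam_pos.ne'
  have h2 := hM.r_pos.ne'
  have h3 : 1 - a ≠ 0 := by linarith
  unfold field
  rw [max_eq_left hδa]
  field_simp
  ring

theorem clip_eq {x : ℝ} (h1 : M.s / M.r ≤ x) (h2 : x ≤ M.g / M.r) :
    max (M.s / M.r) (min x (M.g / M.r)) = x := by
  rw [min_eq_left h2, max_eq_right h1]

theorem Standing.safe_le (hM : M.Standing) : M.s / M.r ≤ M.g / M.r :=
  div_le_div_of_nonneg_right hM.s_lt_g.le hM.r_pos.le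

/-- Below the risky line the net gain from reports is nonpositive, so its inverse vanishes and the
numerator of the middle term is nonpositive. Together with the next lemma it makes g/r the exact
slope on the line, even where the singularity is truncated. -/
theorem Standing.le_field_of_le (hM : M.Standing) {Y δ a x : ℝ} (hY : 0 ≤ Y) (hδ : 0 < δ)
    (hs : M.s ≤ M.g * a) (hx : M.r * x ≤ M.g * a) :
    M.g / M.r ≤ M.field (M.invPhi Y) δ a x := by
  have hr := hM.r_pos
  have hΔ : 0 < max (1 - a) δ := lt_max_of_lt_right hδ
  unfold field
  rw [min_eq_right (sub_nonneg.2 hs), max_eq_left hs, hM.invPhi_of_nonpos hY (by linarith)]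
  have h1 : max (M.s / M.r) (min x (M.g / M.r)) ≤ M.g * a / M.r := by
    refine max_le (by gcongr) (min_le_of_left_le ?_)
    rw [le_div_iff₀ hr]
    linarith
  have h2 := div_nonpos_of_nonpos_of_nonneg (sub_nonpos.2 h1) hΔ.le
  simp only [sub_self, zero_div]
  linarith

theorem Standing.field_le_of_le (hM : M.Standing) {Y δ a x : ℝ} (hY : 0 ≤ Y) (ha : 0 < a)
    (ha1 : a ≤ 1) (hδ : 0 < δ) (hs : M.s ≤ M.g * a) (hx : M.g * a ≤ M.r * x) :
    M.field (M.invPhi Y) δ a x ≤ M.g / M.r := by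
  have hr := hM.r_pos
  have hΔ : 0 < max (1 - a) δ := lt_max_of_lt_right hδ
  unfold field
  rw [min_eq_right (sub_nonneg.2 hs), max_eq_left hs]
  have h1 : M.g * a / M.r ≤ max (M.s / M.r) (min x (M.g / M.r)) := by
    refine le_max_of_le_right (le_min ?_ ?_)
    · rw [div_le_iff₀ hr]
      linarith
    · have := mul_le_of_le_one_right hM.g_pos.le ha1
      gcongr
  have h2 := div_nonneg (sub_nonneg.2 h1) hΔ.le
  have h3 : (0 - M.invPhi Y (M.r * x - M.g * a)) / (M.lam * a * max (1 - a) δ) ≤ 0 :=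
    div_nonpos_of_nonpos_of_nonneg (by linarith [(hM.invPhi_spec hY (M.r * x - M.g * a)).1.1])
      (mul_pos (mul_pos hM.lam_pos ha) hΔ).le
  linarith

/-- At the safe value no net gain is left, the inverse term vanishes, and the numerator is the
affine function whose zero defines `cutSP`. -/
theorem Standing.field_safe_mul (hM : M.Standing) {Y δ a : ℝ} (hY : 0 ≤ Y) (ha : 0 < a)
    (hδ : 0 < δ) (hδa : δ ≤ 1 - a) (hs : M.g * a ≤ M.s) :
    M.lam * a * (1 - a) * M.field (M.invPhi Y) δ a (M.s / M.r) =
      (a - M.cutSP) * ((M.lam * (M.g - M.s) + M.r * M.g) / M.r) := by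
  rw [hM.field_mul ha hδ hδa, clip_eq le_rfl hM.safe_le, min_eq_left (sub_nonpos.2 hs),
    max_eq_right hs, hM.invPhi_of_nonpos hY, sub_zero, hM.safe_report_value]
  rw [mul_div_cancel₀ _ hM.r_pos.ne', sub_self]

theorem Standing.field_safe_at_cutSP (hM : M.Standing) {Y δ : ℝ} (hY : 0 ≤ Y) (hδ : 0 < δ)
    (hδ1 : δ < 1 - M.cutPF) : M.field (M.invPhi Y) δ M.cutSP (M.s / M.r) = 0 := by
  have h1 := hM.cutSP_lt_cutPF
  have h := hM.field_safe_mul hY hM.cutSP_pos hδ (by linarith) (hM.lt_cutPF_iff.1 h1).le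
  rw [sub_self, zero_mul] at h
  have h2 : M.lam * M.cutSP * (1 - M.cutSP) ≠ 0 :=
    (mul_pos (mul_pos hM.lam_pos hM.cutSP_pos) (by linarith)).ne'
  exact (mul_eq_zero.1 h).resolve_left h2

theorem Standing.field_safe_pos (hM : M.Standing) {Y δ a : ℝ} (hY : 0 ≤ Y) (hδ : 0 < δ)
    (hδ1 : δ < 1 - M.cutPF) (ha : M.cutSP < a) : 0 < M.field (M.invPhi Y) δ a (M.s / M.r) := by
  have ha0 := hM.cutSP_pos.trans ha
  rcases lt_or_ge a M.cutPF with h | h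
  · have h1 := hM.field_safe_mul hY ha0 hδ (by linarith) (hM.lt_cutPF_iff.1 h).le
    have h2 : 0 < M.lam * a * (1 - a) := mul_pos (mul_pos hM.lam_pos ha0) (by linarith)
    have h3 := mul_pos (sub_pos.2 ha) (div_pos hM.cutSP_denom_pos hM.r_pos)
    rw [← h1] at h3
    exact (mul_pos_iff_of_pos_left h2).1 h3
  · refine (div_pos hM.g_pos hM.r_pos).trans_le
      (hM.le_field_of_le hY hδ (hM.cutPF_le_iff.1 h) ?_)
    rw [mul_div_cancel₀ _ hM.r_pos.ne']
    exact hM.cutPF_le_iff.1 h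

/-! ### The solution of the differential equation -/

/-- `E` solves the differential equation of the value function, truncated at `1 - δ`. -/
structure IsFieldSolution (M : Market) (δ : ℝ) (E : ℝ → ℝ) : Prop where
  initial : E 0 = M.s / M.r
  continuousOn : ContinuousOn E (Icc 0 1)
  hasDerivAt : ∀ t ∈ Ioo (0 : ℝ) 1,
    HasDerivAt E (M.field (M.invPhi M.topValue) δ (max M.cutSP (min t 1)) (E t)) t

variable {δ : ℝ} {E : ℝ → ℝ}

theorem clip_belief {P t : ℝ} (h : P ≤ t) (h1 : t ≤ 1) : max P (min t 1) = t := by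
  rw [min_eq_left h1, max_eq_right h]

theorem IsFieldSolution.hasDerivAt_of_ge (hE : M.IsFieldSolution δ E) (hM : M.Standing) {t : ℝ}
    (h : M.cutSP ≤ t) (h1 : t < 1) : HasDerivAt E (M.field (M.invPhi M.topValue) δ t (E t)) t := by
  simpa only [clip_belief h h1.le] using hE.hasDerivAt t ⟨hM.cutSP_pos.trans_le h, h1⟩

/-- The clipped belief never falls below `cutSP`, so the slope at s/r is nonnegative, and by
antitonicity still more so below s/r. -/
theorem IsFieldSolution.safe_le (hE : M.IsFieldSolution δ E) (hM : M.Standing) (hδ : 0 < δ)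
    (hδ1 : δ < 1 - M.cutPF) : ∀ t ∈ Icc (0 : ℝ) 1, M.s / M.r ≤ E t := by
  have hY := hM.topValue_pos.le
  intro t ht
  refine neg_le_neg_iff.1 (le_barrier_of_deriv_nonpos (f := fun t => -E t)
    (u := fun _ => -(M.s / M.r)) hE.continuousOn.neg continuousOn_const
    (fun _ _ _ _ _ => le_rfl) (fun x hx => (hE.hasDerivAt x hx).neg) (by simp [hE.initial])
    (fun x hx h => ?_) t ht)
  have hP : M.cutSP ≤ max M.cutSP (min x 1) := le_max_left _ _
  have h1 := hM.field_antitone (hM.invPhi_monotone hY) hδ (hM.cutSP_pos.trans_le hP)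
    (neg_lt_neg_iff.1 h).le
  have h2 : 0 ≤ M.field (M.invPhi M.topValue) δ (max M.cutSP (min x 1)) (M.s / M.r) := by
    rcases hP.eq_or_lt with h | h
    · rw [← h, hM.field_safe_at_cutSP hY hδ hδ1]
    · exact (hM.field_safe_pos hY hδ hδ1 h).le
  linarith

/-- Up to `cutSP` the clipped belief is frozen at `cutSP`, where s/r is a rest point; antitonicity
prevents the solution from leaving it upwards. -/
theorem IsFieldSolution.eq_safe (hE : M.IsFieldSolution δ E) (hM : M.Standing) (hδ : 0 < δ)
    (hδ1 : δ < 1 - M.cutPF) : ∀ t ∈ Icc 0 M.cutSP, E t = M.s / M.r := by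
  have hY := hM.topValue_pos.le
  have hP1 : M.cutSP < 1 := hM.cutSP_lt_cutPF.trans hM.cutPF_lt_one
  intro t ht
  refine le_antisymm ?_ (hE.safe_le hM hδ hδ1 t ⟨ht.1, ht.2.trans hP1.le⟩)
  refine le_barrier_of_deriv_nonpos (u := fun _ => M.s / M.r)
    (hE.continuousOn.mono (Icc_subset_Icc_right hP1.le)) continuousOn_const
    (fun _ _ _ _ _ => le_rfl) (fun x hx => hE.hasDerivAt x ⟨hx.1, hx.2.trans hP1⟩)
    hE.initial.le (fun x hx h => ?_) t ht
  have hP : max M.cutSP (min x 1) = M.cutSP := max_eq_left (min_le_of_left_le hx.2.le)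
  rw [hP, ← hM.field_safe_at_cutSP hY hδ hδ1]
  exact hM.field_antitone (hM.invPhi_monotone hY) hδ hM.cutSP_pos h.le

theorem IsFieldSolution.safe_lt (hE : M.IsFieldSolution δ E) (hM : M.Standing) (hδ : 0 < δ)
    (hδ1 : δ < 1 - M.cutPF) {t : ℝ} (ht : t ∈ Ioo M.cutSP 1) : M.s / M.r < E t := by
  have ht0 := hM.cutSP_pos.trans ht.1
  refine lt_of_le_of_ne (hE.safe_le hM hδ hδ1 t ⟨ht0.le, ht.2.le⟩) fun h => ?_
  -- Touching the lower barrier would be a local minimum, but the slope there is strictly positive.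
  have hmin : IsLocalMin E t := by
    filter_upwards [Icc_mem_nhds ht0 ht.2] with x hx
    rw [← h]
    exact hE.safe_le hM hδ hδ1 x hx
  have h0 := hmin.hasDerivAt_eq_zero (hE.hasDerivAt_of_ge hM ht.1.le ht.2)
  rw [← h] at h0
  exact (hM.field_safe_pos hM.topValue_pos.le hδ hδ1 ht.1).ne' h0

theorem IsFieldSolution.risky_le (hE : M.IsFieldSolution δ E) (hM : M.Standing) (hδ : 0 < δ)
    (hδ1 : δ < 1 - M.cutPF) : ∀ t ∈ Icc M.cutPF 1, M.g * t ≤ M.r * E t := by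
  have hQ := hM.cutSP_pos.trans hM.cutSP_lt_cutPF
  intro t ht
  have := le_barrier_of_deriv_nonpos (f := fun t => M.g * t - M.r * E t) (u := fun _ => 0)
    (a := M.cutPF) (b := 1) ((continuousOn_const.mul continuousOn_id).sub
      (continuousOn_const.mul (hE.continuousOn.mono (Icc_subset_Icc_left hQ.le))))
    continuousOn_const (fun _ _ _ _ _ => le_rfl)
    (fun x hx => ((hasDerivAt_id x).const_mul M.g).sub ((hE.hasDerivAt_of_ge hM
      (hM.cutSP_lt_cutPF.le.trans hx.1.le) hx.2).const_mul M.r)) ?_ (fun x hx h => ?_) t ht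
  · simpa using this
  · have h1 := hE.safe_le hM hδ hδ1 M.cutPF ⟨hQ.le, hM.cutPF_lt_one.le⟩
    have h2 : M.g * M.cutPF = M.s := mul_div_cancel₀ _ hM.g_pos.ne'
    rw [div_le_iff₀ hM.r_pos] at h1
    simp only [h2]
    linarith
  · have h1 := hM.le_field_of_le hM.topValue_pos.le hδ
      (hM.cutPF_le_iff.1 hx.1.le) (x := E x) (sub_pos.1 h).le
    rw [div_le_iff₀ hM.r_pos] at h1
    linarith

theorem IsFieldSolution.max_le (hE : M.IsFieldSolution δ E) (hM : M.Standing) (hδ : 0 < δ)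
    (hδ1 : δ < 1 - M.cutPF) {t : ℝ} (ht : t ∈ Icc (0 : ℝ) 1) :
    max (M.g * t) M.s ≤ M.r * E t := by
  have h1 := hE.safe_le hM hδ hδ1 t ht
  rw [div_le_iff₀ hM.r_pos] at h1
  refine _root_.max_le ?_ (by linarith)
  rcases lt_or_ge t M.cutPF with h | h
  · linarith [hM.lt_cutPF_iff.1 h]
  · exact hE.risky_le hM hδ hδ1 t ⟨h, ht.2⟩

/-- Above g/r the clipped value equals g/r, and only nonpositive terms remain in the slope. With the
lower bound s/r this shows that the clipping in `field` is inactive. -/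
theorem IsFieldSolution.le_sure (hE : M.IsFieldSolution δ E) (hM : M.Standing) (hδ : 0 < δ)
    (hδ1 : δ < 1 - M.cutPF) : ∀ t ∈ Icc M.cutSP (1 - δ), E t ≤ M.g / M.r := by
  have hP := hM.cutSP_pos
  refine le_barrier_of_deriv_nonpos (u := fun _ => M.g / M.r)
    (hE.continuousOn.mono (Icc_subset_Icc hP.le (by linarith))) continuousOn_const
    (fun _ _ _ _ _ => le_rfl) (fun x hx => hE.hasDerivAt_of_ge hM hx.1.le (by linarith [hx.2])) ?_
    (fun x hx h => ?_)
  · rw [hE.eq_safe hM hδ hδ1 _ ⟨hP.le, le_rfl⟩]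
    exact hM.safe_le
  · have hx0 := hP.trans hx.1
    have h1 := hM.field_mul (p := M.invPhi M.topValue) hx0 hδ (by linarith [hx.2]) (E x)
    rw [min_eq_right h.le, max_eq_right hM.safe_le, sub_self, mul_zero, zero_add] at h1
    have h2 := (hM.invPhi_spec hM.topValue_pos.le (M.r * E x - max (M.g * x) M.s)).1.1
    have h3 : 0 < M.lam * x * (1 - x) := mul_pos (mul_pos hM.lam_pos hx0) (by linarith [hx.2])
    have h4 := min_le_right (M.g * x - M.s) 0
    by_contra! h5
    have := mul_pos h3 h5
    linarith

/-- Above this moving, nondecreasing barrier the inverse is clipped at `topValue`, which dominates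
λt(g/r - s/r), so the slope is nonpositive. Hence the clipping in `invPhi` is inactive as well, and
the ODE is equivalent to the Bellman equation. -/
theorem IsFieldSolution.le_add_phi (hE : M.IsFieldSolution δ E) (hM : M.Standing) (hδ : 0 < δ)
    (hδ1 : δ < 1 - M.cutPF) {t : ℝ} (ht : t ∈ Icc M.cutSP (1 - δ)) :
    M.r * E t ≤ max (M.g * t) M.s + M.phi M.topValue := by
  have hP := hM.cutSP_pos
  have hr := hM.r_pos
  have hg := hM.g_pos
  have := le_barrier_of_deriv_nonpos
    (u := fun t => (max (M.g * t) M.s + M.phi M.topValue) / M.r)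
    (hE.continuousOn.mono (Icc_subset_Icc hP.le (by linarith))) (by fun_prop)
    (fun x _ y _ hxy => by dsimp only; gcongr)
    (fun x hx => hE.hasDerivAt_of_ge hM hx.1.le (by linarith [hx.2])) ?_ (fun x hx h => ?_) t ht
  · rw [le_div_iff₀ hr] at this
    linarith
  · rw [hE.eq_safe hM hδ hδ1 _ ⟨hP.le, le_rfl⟩]
    have h1 := hM.phi_nonneg M.topValue
    have h2 := le_max_right (M.g * M.cutSP) M.s
    gcongr
    linarith
  · rw [div_lt_iff₀ hr] at h
    have hx0 := hP.trans hx.1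
    have h1 := hM.field_mul (p := M.invPhi M.topValue) hx0 hδ (by linarith [hx.2]) (E x)
    rw [hM.invPhi_of_phi_le hM.topValue_pos.le (u := M.r * E x - max (M.g * x) M.s)
      (by linarith)] at h1
    have h3 : 0 < M.lam * x * (1 - x) := mul_pos (mul_pos hM.lam_pos hx0) (by linarith [hx.2])
    have h4 := min_le_right (M.g * x - M.s) 0
    have h6 : M.lam * x * (M.g / M.r - max (M.s / M.r) (min (E x) (M.g / M.r))) ≤
        M.topValue := by
      have e1 : M.topValue = M.lam * (M.g / M.r - M.s / M.r) := by unfold topValue; ring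
      have e2 := le_max_left (M.s / M.r) (min (E x) (M.g / M.r))
      have e3 : M.lam * x ≤ M.lam := mul_le_of_le_one_right hM.lam_pos.le (by linarith [hx.2])
      rw [e1]
      exact mul_le_mul e3 (by linarith)
        (sub_nonneg.2 (_root_.max_le hM.safe_le (min_le_right _ _))) hM.lam_pos.le
    by_contra! h5
    have := mul_pos h3 h5
    linarith

/-- The value of a report along the solution of the differential equation. -/
theorem IsFieldSolution.field_eq (hE : M.IsFieldSolution δ E) (hM : M.Standing) (hδ : 0 < δ)
    (hδ1 : δ < 1 - M.cutPF) {t : ℝ} (ht : t ∈ Icc M.cutSP (1 - δ)) :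
    M.lam * t * (1 - t) * M.field (M.invPhi M.topValue) δ t (E t) =
      M.lam * t * (M.g / M.r - E t) + min (M.g * t - M.s) 0 -
        M.invPhi M.topValue (M.r * E t - max (M.g * t) M.s) := by
  have h0 := hM.cutSP_pos.trans_le ht.1
  rw [hM.field_mul h0 hδ (by linarith [ht.2]),
    clip_eq (hE.safe_le hM hδ hδ1 t ⟨h0.le, by linarith [ht.2]⟩) (hE.le_sure hM hδ hδ1 t ht)]

theorem IsFieldSolution.phi_invPhi_eq (hE : M.IsFieldSolution δ E) (hM : M.Standing) (hδ : 0 < δ)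
    (hδ1 : δ < 1 - M.cutPF) {t : ℝ} (ht : t ∈ Icc M.cutSP (1 - δ)) :
    M.phi (M.invPhi M.topValue (M.r * E t - max (M.g * t) M.s)) =
      M.r * E t - max (M.g * t) M.s := by
  have h0 := hM.cutSP_pos.trans_le ht.1
  refine hM.phi_invPhi hM.topValue_pos.le ⟨?_, ?_⟩
  · linarith [hE.max_le hM hδ hδ1 ⟨h0.le, by linarith [ht.2]⟩]
  · linarith [hE.le_add_phi hM hδ hδ1 ht]

/-- Experimentation ends before belief one, provided that the truncation is far enough to the
right. -/
theorem Standing.exists_truncation (hM : M.Standing) : ∃ δ, 0 < δ ∧ δ < 1 - M.cutPF ∧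
    ∀ E, M.IsFieldSolution δ E → ∃ t ∈ Icc M.cutPF (1 - δ), M.r * E t = M.g * t := by
  obtain ⟨C, hC, hφC⟩ := hM.exists_phi_le_sq
  have hl := hM.lam_pos
  have hr := hM.r_pos
  have hQ1 : 0 < 1 - M.cutPF := sub_pos.2 hM.cutPF_lt_one
  have hQ := hM.cutSP_pos.trans hM.cutSP_lt_cutPF
  -- With u = rE - gt, the ODE bounds u' by -rψ/(λ(1 - t)), where ψ is the report value, and √u ≤ √C
  -- ψ. Hence (√u)' ≤ -k/(1 - t), while √u is at most B at `cutPF`. The choice of δ lets log(1 - t)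
  -- fall by B/k + 1.
  set k : ℝ := M.r / (2 * M.lam * Real.sqrt C) with hk
  have hkpos : 0 < k := by positivity
  set B : ℝ := Real.sqrt (M.phi M.topValue) with hB
  have hB0 : 0 ≤ B := Real.sqrt_nonneg _
  set δ : ℝ := (1 - M.cutPF) * Real.exp (-(B / k + 1)) with hδdef
  have hδ : 0 < δ := by positivity
  have hδ1 : δ < 1 - M.cutPF := by
    refine mul_lt_of_lt_one_right hQ1 (Real.exp_lt_one_iff.2 ?_)
    have : 0 ≤ B / k := by positivity
    linarith
  refine ⟨δ, hδ, hδ1, fun E hE => ?_⟩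
  by_contra! hne
  have hmem : ∀ t ∈ Icc M.cutPF (1 - δ), t ∈ Icc M.cutSP (1 - δ) := fun t ht =>
    ⟨hM.cutSP_lt_cutPF.le.trans ht.1, ht.2⟩
  set u : ℝ → ℝ := fun t => M.r * E t - M.g * t with hu
  have hupos : ∀ t ∈ Icc M.cutPF (1 - δ), 0 < u t := fun t ht =>
    sub_pos.2 (lt_of_le_of_ne (hE.risky_le hM hδ hδ1 t ⟨ht.1, by linarith [ht.2]⟩)
      (hne t ht).symm)
  have huc : ContinuousOn u (Icc M.cutPF (1 - δ)) :=
    (continuousOn_const.mul (hE.continuousOn.mono (Icc_subset_Icc hQ.le (by linarith)))).sub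
      (by fun_prop)
  have hanti : AntitoneOn (fun t => Real.sqrt (u t) - k * Real.log (1 - t))
      (Icc M.cutPF (1 - δ)) := by
    refine antitoneOn_of_hasDerivWithinAt_nonpos (f' := fun t =>
      (M.r * M.field (M.invPhi M.topValue) δ t (E t) - M.g * 1) / (2 * Real.sqrt (u t)) -
        k * (-1 / (1 - t))) (convex_Icc _ _) ?_ (fun t ht => ?_) (fun t ht => ?_)
    · refine huc.sqrt.sub (continuousOn_const.mul (ContinuousOn.log (by fun_prop) ?_))
      intro t ht
      linarith [ht.2]
    · rw [interior_Icc] at ht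
      have ht' := Ioo_subset_Icc_self ht
      have hd := ((hE.hasDerivAt_of_ge hM (hmem t ht').1 (by linarith [ht.2])).const_mul M.r).sub
        ((hasDerivAt_id t).const_mul M.g)
      have hd2 : HasDerivAt (fun t : ℝ => 1 - t) (-1) t := (hasDerivAt_id t).const_sub 1
      exact ((hd.sqrt (hupos t ht').ne').sub ((hd2.log (by linarith [ht.2])).const_mul
        k)).hasDerivWithinAt
    · rw [interior_Icc] at ht
      have ht' := Ioo_subset_Icc_self ht
      have hup := hupos t ht'
      have ht0 : 0 < t := hQ.trans ht.1
      have ht1 : 0 < 1 - t := by linarith [ht.2]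
      have hs : M.s ≤ M.g * t := hM.cutPF_le_iff.1 ht.1.le
      have h1 := hE.field_eq hM hδ hδ1 (hmem t ht')
      have h2 := hE.phi_invPhi_eq hM hδ hδ1 (hmem t ht')
      rw [max_eq_left hs] at h1 h2
      rw [min_eq_right (sub_nonneg.2 hs)] at h1
      set ψ := M.invPhi M.topValue (M.r * E t - M.g * t) with hψ
      have hψ0 : 0 ≤ ψ := (hM.invPhi_spec hM.topValue_pos.le _).1.1
      have h3 : Real.sqrt (u t) ≤ Real.sqrt C * ψ := by
        refine Real.sqrt_le_iff.2 ⟨by positivity, ?_⟩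
        rw [mul_pow, Real.sq_sqrt hC.le]
        have := hφC ψ hψ0
        rwa [h2] at this
      set f := M.field (M.invPhi M.topValue) δ t (E t) with hf
      have hsq : 0 < Real.sqrt (u t) := Real.sqrt_pos.2 hup
      have hsC : 0 < Real.sqrt C := Real.sqrt_pos.2 hC
      have h4 : M.lam * t * (1 - t) * (M.r * f - M.g) = -(M.lam * t * u t) - M.r * ψ := by
        have e : M.r * (M.g / M.r) = M.g := mul_div_cancel₀ _ hr.ne'
        simp only [hu]
        linear_combination M.r * h1 + M.lam * t * e
      have h5 : M.lam * (1 - t) * (M.r * f - M.g) ≤ -(M.r * ψ) := by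
        have e1 : 0 < M.lam * t * u t := by positivity
        have e2 : t * (M.lam * (1 - t) * (M.r * f - M.g)) ≤ t * -(M.r * ψ) := by
          have e3 : t * (M.r * ψ) ≤ M.r * ψ :=
            mul_le_of_le_one_left (by positivity) (by linarith)
          linarith
        exact le_of_mul_le_mul_left e2 ht0
      have h6 : (M.r * f - M.g * 1) / (2 * Real.sqrt (u t)) ≤ -(k / (1 - t)) := by
        rw [div_le_iff₀ (by positivity), hk]
        have e1 : M.r * f - M.g * 1 ≤ -(M.r * ψ) / (M.lam * (1 - t)) := by
          rw [le_div_iff₀ (by positivity)]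
          linarith
        have e2 : -(M.r * ψ) / (M.lam * (1 - t)) ≤
            -(M.r / (2 * M.lam * Real.sqrt C) / (1 - t)) * (2 * Real.sqrt (u t)) := by
          have e3 : -(M.r / (2 * M.lam * Real.sqrt C) / (1 - t)) * (2 * Real.sqrt (u t)) =
              -(M.r * (Real.sqrt (u t) / Real.sqrt C)) / (M.lam * (1 - t)) := by
            field_simp
          rw [e3]
          have e4 : Real.sqrt (u t) / Real.sqrt C ≤ ψ := by
            rw [div_le_iff₀ hsC]; linarith
          gcongr
        exact e1.trans e2
      have h7 : k * (-1 / (1 - t)) = -(k / (1 - t)) := by ring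
      rw [h7]
      linarith
  have hQδ : M.cutPF ≤ 1 - δ := by linarith
  have hfin := hanti (left_mem_Icc.2 hQδ) (right_mem_Icc.2 hQδ) hQδ
  have hlog : Real.log δ = Real.log (1 - M.cutPF) - (B / k + 1) := by
    rw [hδdef, Real.log_mul hQ1.ne' (Real.exp_pos _).ne', Real.log_exp]
    ring
  have hBQ : Real.sqrt (u M.cutPF) ≤ B := by
    refine Real.sqrt_le_sqrt ?_
    have h1 := hE.le_add_phi hM hδ hδ1 (hmem _ (left_mem_Icc.2 hQδ))
    rw [max_eq_left (hM.cutPF_le_iff.1 le_rfl)] at h1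
    simp only [hu]
    linarith
  -- The integrated inequality would give √u ≤ -k at 1 - δ.
  have hk2 : k * (B / k + 1) = B + k := by field_simp
  simp only [sub_sub_cancel, hlog] at hfin
  have := Real.sqrt_nonneg (u (1 - δ))
  linarith

/-- The belief at which experimentation ends. -/
theorem IsFieldSolution.exists_cutoff (hE : M.IsFieldSolution δ E) (hM : M.Standing) (hδ : 0 < δ)
    (hδ1 : δ < 1 - M.cutPF) (hhit : ∃ t ∈ Icc M.cutPF (1 - δ), M.r * E t = M.g * t) :
    ∃ N, M.cutPF < N ∧ N ≤ 1 - δ ∧ (∀ t ∈ Ico M.cutPF N, M.g * t < M.r * E t) ∧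
      ∀ t ∈ Icc N 1, M.r * E t = M.g * t := by
  have hPQ := hM.cutSP_lt_cutPF
  have hQ := hM.cutSP_pos.trans hPQ
  have hr := hM.r_pos
  set S : Set ℝ := {t ∈ Icc M.cutPF (1 - δ) | M.r * E t = M.g * t} with hS
  have hEcQ : ContinuousOn E (Icc M.cutPF (1 - δ)) :=
    hE.continuousOn.mono (Icc_subset_Icc hQ.le (by linarith))
  have hSc : IsCompact S := by
    have h := ContinuousOn.preimage_isClosed_of_isClosed (t := {(0 : ℝ)})
      ((continuousOn_const.mul hEcQ).sub (by fun_prop) :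
        ContinuousOn (fun t => M.r * E t - M.g * t) (Icc M.cutPF (1 - δ)))
      isClosed_Icc isClosed_singleton
    refine isCompact_Icc.of_isClosed_subset (s := Icc M.cutPF (1 - δ)) ?_ (sep_subset _ _)
    convert h using 1
    ext t
    simp [hS, sub_eq_zero]
  have hSne : S.Nonempty := let ⟨t, ht, h⟩ := hhit; ⟨t, ht, h⟩
  obtain ⟨N, hNS, hNle⟩ : ∃ N ∈ S, ∀ t ∈ S, N ≤ t :=
    ⟨sInf S, hSc.sInf_mem hSne, fun t ht => csInf_le hSc.bddBelow ht⟩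
  obtain ⟨⟨hN1, hN2⟩, hN⟩ := hNS
  -- At the myopic cutoff the risky line equals s, but the solution already lies strictly above s/r.
  have hQN : M.cutPF < N := by
    refine lt_of_le_of_ne hN1 fun h => ?_
    have hQeq : M.g * M.cutPF = M.s := mul_div_cancel₀ _ hM.g_pos.ne'
    rw [← h, hQeq] at hN
    have := hE.safe_lt hM hδ hδ1 ⟨hPQ, hM.cutPF_lt_one⟩
    rw [div_lt_iff₀ hr] at this
    linarith
  refine ⟨N, hQN, hN2, fun t ht => ?_, fun t ht => ?_⟩
  · refine lt_of_le_of_ne (hE.risky_le hM hδ hδ1 t ⟨ht.1, by linarith [ht.2]⟩) fun h => ?_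
    exact absurd (hNle t ⟨⟨ht.1, by linarith [ht.2]⟩, h.symm⟩) (not_le.2 ht.2)
  · refine le_antisymm ?_ (hE.risky_le hM hδ hδ1 t ⟨hN1.trans ht.1, ht.2⟩)
    have := le_barrier_of_deriv_nonpos (f := fun t => M.r * E t - M.g * t) (u := fun _ => 0)
      (a := N) (b := 1) ((continuousOn_const.mul (hE.continuousOn.mono
        (Icc_subset_Icc_left (hQ.trans hQN).le))).sub (by fun_prop))
      continuousOn_const (fun _ _ _ _ _ => le_rfl)
      (fun x hx => ((hE.hasDerivAt_of_ge hM ((hPQ.trans hQN).trans hx.1).le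
        hx.2).const_mul M.r).sub ((hasDerivAt_id x).const_mul M.g)) (by simp [hN])
      (fun x hx h => ?_) t ht
    · simpa using this
    · have h1 := hM.field_le_of_le hM.topValue_pos.le ((hQ.trans hQN).trans hx.1) hx.2.le hδ
        (hM.cutPF_le_iff.1 (hQN.trans hx.1).le) (x := E x) (sub_pos.1 h).le
      rw [le_div_iff₀ hr] at h1
      linarith

/-- The value function, as a solution of its differential equation. -/
theorem Standing.exists_isCandidate (hM : M.Standing) : ∃ W W' αFN, M.IsCandidate W W' αFN := by
  obtain ⟨δ, hδ, hδ1, hhit⟩ := hM.exists_truncation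
  have hP := hM.cutSP_pos
  have hPQ := hM.cutSP_lt_cutPF
  have hQ1 := hM.cutPF_lt_one
  have hQ := hP.trans hPQ
  have hY := hM.topValue_pos
  have hr := hM.r_pos
  obtain ⟨E, hE0, hEc, hEd⟩ := hM.exists_field_solution hδ hP (hPQ.trans hQ1).le hY (M.s / M.r)
  have hE : M.IsFieldSolution δ E := ⟨hE0, hEc, hEd⟩
  obtain ⟨N, hQN, hN2, hbefore, hafter⟩ := hE.exists_cutoff hM hδ hδ1 (hhit E hE)
  have hN1 := hQN.le
  have hN1' : N < 1 := by linarith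
  obtain ⟨W', hW'⟩ : ∃ W' : ℝ → ℝ, W' = fun t =>
    M.field (M.invPhi M.topValue) δ (max M.cutSP (min t 1)) (E t) := ⟨_, rfl⟩
  have hW'ge : ∀ t, M.cutSP ≤ t → t < 1 → W' t = M.field (M.invPhi M.topValue) δ t (E t) :=
    fun t h h1 => by rw [hW']; simp only [clip_belief h h1.le]
  have hleft : ∀ t ∈ Ioo 0 M.cutSP, M.reportValue E W' t ≤ 0 ∧
      max (M.g * t) M.s = M.s := by
    intro t ht
    have h1 : E t = M.s / M.r := hE.eq_safe hM hδ hδ1 t ⟨ht.1.le, ht.2.le⟩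
    have h2 : W' t = 0 := by
      simp only [hW']
      rw [max_eq_left (min_le_of_left_le ht.2.le), h1, hM.field_safe_at_cutSP hY.le hδ hδ1]
    have h3 := hM.lt_cutPF_iff.1 (ht.2.trans hPQ)
    refine ⟨?_, max_eq_right h3.le⟩
    unfold reportValue
    rw [h1, h2, mul_zero, sub_zero, min_eq_left (by linarith), hM.safe_report_value]
    exact mul_nonpos_of_nonpos_of_nonneg (by linarith [ht.2])
      (div_pos hM.cutSP_denom_pos hr).le
  have hmid : ∀ t ∈ Icc M.cutSP (1 - δ), M.reportValue E W' t =
      M.invPhi M.topValue (M.r * E t - max (M.g * t) M.s) := by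
    intro t ht
    have := hE.field_eq hM hδ hδ1 ht
    unfold reportValue
    rw [hW'ge t ht.1 (by linarith [ht.2])]
    linear_combination -this
  have hright : ∀ t ∈ Ico N 1, M.reportValue E W' t = 0 := by
    intro t ht
    have hs : M.s ≤ M.g * t := hM.cutPF_le_iff.1 (hN1.trans ht.1)
    have h1 := hafter t ⟨ht.1, ht.2.le⟩
    have ht0 := (hQ.trans hQN).trans_le ht.1
    -- The two one-sided estimates on the risky line pinch the slope.
    have h2 : W' t = M.g / M.r := by
      rw [hW'ge t ((hPQ.trans hQN).le.trans ht.1) ht.2]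
      exact le_antisymm (hM.field_le_of_le hY.le ht0 ht.2.le hδ hs h1.ge)
        (hM.le_field_of_le hY.le hδ hs h1.le)
    have h3 : E t = M.g * t / M.r := by rw [eq_div_iff hr.ne']; linarith
    unfold reportValue
    rw [h2, h3, min_eq_right (by linarith)]
    ring
  -- Clipping the belief at `cutSP` and truncating at 1 - δ keep the slope continuous up to both
  -- endpoints, hence bounded.
  have hW'c : ContinuousOn W' (Icc 0 1) := by
    rw [hW']
    exact (hM.field_continuous (hM.invPhi_continuous hY) hδ hP).comp_continuousOn
      (continuousOn_id.prodMk hEc)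
  refine ⟨E, W', N, ⟨by simpa only [hW'] using hEd, hW'c.mono Ioo_subset_Icc_self, ?_, hQN, hN1',
    fun t ht => hE.eq_safe hM hδ hδ1 t ⟨ht.1.le, ht.2⟩, fun t ht => ?_, fun t ht => ?_, fun t ht => ?_,
    fun t ht => (hleft t ht).1, fun t ht => ?_, fun t ht => (hright t ht).le⟩⟩
  · obtain ⟨C1, h1⟩ := isCompact_Icc.exists_bound_of_continuousOn hEc
    obtain ⟨C2, h2⟩ := isCompact_Icc.exists_bound_of_continuousOn hW'c
    exact ⟨max C1 C2, fun t ht => ⟨(h1 t (Ioo_subset_Icc_self ht)).trans (le_max_left _ _),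
      (h2 t (Ioo_subset_Icc_self ht)).trans (le_max_right _ _)⟩⟩
  · rw [eq_div_iff hr.ne']
    linarith [hafter t ⟨ht.1, ht.2.le⟩]
  · rcases lt_or_ge t M.cutSP with h | h
    · obtain ⟨h1, h2⟩ := hleft t ⟨ht.1, h⟩
      rw [hM.phi_of_nonpos h1, h2, hE.eq_safe hM hδ hδ1 t ⟨ht.1.le, h.le⟩,
        mul_div_cancel₀ _ hr.ne', add_zero]
    rcases lt_or_ge t N with h' | h'
    · rw [hmid t ⟨h, by linarith⟩, hE.phi_invPhi_eq hM hδ hδ1 ⟨h, by linarith⟩]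
      ring
    · rw [hright t ⟨h', ht.2⟩, hM.phi_of_nonpos le_rfl, add_zero,
        max_eq_left (hM.cutPF_le_iff.1 (hN1.trans h'))]
      exact hafter t ⟨h', ht.2.le⟩
  · rcases lt_or_ge t M.cutSP with h | h
    · exact (hleft t ⟨ht.1, h⟩).1.trans_lt hM.cbar_pos
    rcases lt_or_ge t N with h' | h'
    · rw [hmid t ⟨h, by linarith⟩]
      exact (hM.invPhi_spec hY.le _).1.2.trans_lt hM.topValue_lt_cbar
    · rw [hright t ⟨h', ht.2⟩]
      exact hM.cbar_pos
  · rw [hmid t ⟨ht.1.le, by linarith [ht.2]⟩]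
    refine hM.invPhi_pos hY (sub_pos.2 (max_lt ?_ ?_))
    · rcases lt_or_ge t M.cutPF with h | h
      · have h1 := hE.safe_le hM hδ hδ1 t ⟨(hP.trans ht.1).le, (ht.2.trans hN1').le⟩
        rw [div_le_iff₀ hr] at h1
        linarith [hM.lt_cutPF_iff.1 h]
      · exact hbefore t ⟨h, ht.2⟩
    · have h1 := hE.safe_lt hM hδ hδ1 ⟨ht.1, ht.2.trans hN1'⟩
      rw [div_lt_iff₀ hr] at h1
      linarith

variable {M : Market} {W W' : ℝ → ℝ} {αFN : ℝ}

/-! ### The Bellman equation -/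

/-- The profit flow lost by promoting the arm `ℓ` at belief `α`. -/
noncomputable def armLoss (M : Market) (α : ℝ) : Arm → ℝ
  | Arm.risky => max (M.g * α) M.s - M.g * α
  | Arm.safe => max (M.g * α) M.s - M.s

theorem armLoss_nonneg (α : ℝ) (ℓ : Arm) : 0 ≤ M.armLoss α ℓ := by
  cases ℓ
  · exact sub_nonneg.2 (le_max_left _ _)
  · exact sub_nonneg.2 (le_max_right _ _)

/-- The promoted arm matters only for buyers who do not report, so the wrong arm costs `armLoss`
times their share. This decouples the choice of the arm from that of the bonus. -/
theorem bellman_eq {α : ℝ} (hd : HasDerivAt W (W' α) α) (a : StageAction) :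
    M.bellman W α a = max (M.g * α) M.s + M.H a.bonus * (M.reportValue W W' α - a.bonus) -
      (1 - M.H a.bonus) * M.armLoss α a.arm := by
  have hmm : min (M.g * α - M.s) 0 = M.g * α - max (M.g * α) M.s := by
    rcases le_total (M.g * α) M.s with h | h
    · rw [min_eq_left (sub_nonpos.2 h), max_eq_right h]
    · rw [min_eq_right (sub_nonneg.2 h), max_eq_left h, sub_self]
  rcases a with ⟨ℓ, b⟩
  cases ℓ <;> simp only [bellman, flow, reportValue, armLoss, hd.deriv, hmm] <;>
    simp only [g] <;> ring

namespace IsCandidate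

theorem bellman_le (hW : M.IsCandidate W W' αFN) (hM : M.Standing)
    {α : ℝ} (hα : α ∈ Ioo (0 : ℝ) 1) {a : StageAction} (ha : M.Feasible a) :
    M.bellman W α a ≤ M.r * W α := by
  rw [bellman_eq (hW.hasDerivAt α hα), hW.value_eq α hα]
  have h1 := hM.le_phi (M.reportValue W W' α) ha
  have h2 := mul_nonneg (sub_nonneg.2 (hM.H_le_one ha)) (M.armLoss_nonneg α a.arm)
  linarith

theorem bellman_attained (hW : M.IsCandidate W W' αFN) {α : ℝ}
    (hα : α ∈ Ioo (0 : ℝ) 1) {ℓ : Arm} (hℓ : M.armLoss α ℓ = 0) :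
    M.bellman W α ⟨ℓ, M.bestBonus (M.reportValue W W' α)⟩ = M.r * W α := by
  rw [bellman_eq (hW.hasDerivAt α hα), hW.value_eq α hα, hℓ, mul_zero, sub_zero]
  rfl

theorem armEq (hW : M.IsCandidate W W' αFN) (hM : M.Standing)
    {α : ℝ} (hα : α ∈ Ioo (0 : ℝ) 1) {ℓ : Arm} (hℓ : M.armLoss α ℓ = 0) :
    M.ArmEq ℓ W α :=
  ⟨⟨_, hM.bestBonus_mem _, hW.bellman_attained hα hℓ⟩, by
    rintro _ ⟨b, hb, rfl⟩
    exact hW.bellman_le hM hα hb⟩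

/-- Actions that attain the maximum promote the better arm and pay the best bonus. -/
theorem of_bellman_eq (hW : M.IsCandidate W W' αFN) (hM : M.Standing)
    {α : ℝ} (hα : α ∈ Ioo (0 : ℝ) 1) {a : StageAction} (ha : M.Feasible a)
    (h : M.bellman W α a = M.r * W α) : M.armLoss α a.arm = 0 ∧
      M.H a.bonus * (M.reportValue W W' α - a.bonus) = M.phi (M.reportValue W W' α) := by
  rw [bellman_eq (hW.hasDerivAt α hα), hW.value_eq α hα] at h
  have h1 := hM.le_phi (M.reportValue W W' α) ha
  have h2 := mul_nonneg (sub_nonneg.2 (hM.H_le_one ha)) (M.armLoss_nonneg α a.arm)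
  have h3 : M.H a.bonus * (M.reportValue W W' α - a.bonus) = M.phi (M.reportValue W W' α) := by
    linarith
  have h4 : (1 - M.H a.bonus) * M.armLoss α a.arm = 0 := by linarith
  -- If every buyer reported, the promoted arm would be irrelevant. This is excluded because the
  -- report value, and hence the bonus, stays below the largest cost.
  refine ⟨(mul_eq_zero.1 h4).resolve_left fun h5 => ?_, h3⟩
  have hb : a.bonus < M.cbar := by
    rcases le_or_gt (M.reportValue W W' α) 0 with hy | hy
    · rw [hM.eq_zero_of_eq_phi hy ha h3]
      exact hM.cbar_pos
    · exact (hM.pos_of_eq_phi hy ha h3).2.trans (hW.reportValue_lt α hα)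
  linarith [hM.H_lt_one ha hb]

theorem prescribed (hW : M.IsCandidate W W' αFN) (hM : M.Standing)
    {α : ℝ} (hα : α ∈ Ioo (0 : ℝ) 1) {a : StageAction} (ha : M.Feasible a)
    (h : M.bellman W α a = M.r * W α) : M.Prescribed M.cutSP M.cutPF αFN α a := by
  obtain ⟨h1, h2⟩ := hW.of_bellman_eq hM hα ha h
  have hsafe : α < M.cutPF → a.arm = Arm.safe := fun hlt => by
    have h3 := hM.lt_cutPF_iff.1 hlt
    cases hℓ : a.arm
    · rw [hℓ, armLoss, max_eq_right h3.le] at h1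
      linarith
    · rfl
  have hrisky : M.cutPF < α → a.arm = Arm.risky := fun hlt => by
    have h3 := mul_lt_mul_of_pos_left hlt hM.g_pos
    have h4 : M.g * M.cutPF = M.s := mul_div_cancel₀ _ hM.g_pos.ne'
    rw [h4] at h3
    cases hℓ : a.arm
    · rfl
    · rw [hℓ, armLoss, max_eq_left h3.le] at h1
      linarith
  have hpos : 0 < M.reportValue W W' α → 0 < a.bonus ∧ a.bonus < M.cbar := fun hy =>
    let h3 := hM.pos_of_eq_phi hy ha h2
    ⟨h3.1, h3.2.trans (hW.reportValue_lt α hα)⟩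
  have hPQ := hM.cutSP_lt_cutPF
  refine ⟨fun hm => ⟨hsafe (hm.2.trans hPQ), ?_⟩, fun hm => ⟨hsafe hm.2, ?_⟩,
    fun hm => ⟨hrisky hm.1, ?_⟩, fun hm => ⟨hrisky (hW.cutPF_lt.trans hm.1), ?_⟩⟩
  · exact hM.eq_zero_of_eq_phi (hW.reportValue_nonpos_left α hm) ha h2
  · exact hpos (hW.reportValue_pos α ⟨hm.1, hm.2.trans hW.cutPF_lt⟩)
  · exact hpos (hW.reportValue_pos α ⟨hPQ.trans hm.1, hm.2⟩)
  · exact hM.eq_zero_of_eq_phi (hW.reportValue_nonpos_right α ⟨hm.1.le, hm.2⟩) ha h2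

theorem risky_lt (hW : M.IsCandidate W W' αFN) (hM : M.Standing)
    {α : ℝ} (hα : α ∈ Ioo 0 αFN) : M.g * α < M.r * W α := by
  have hα1 : α ∈ Ioo (0 : ℝ) 1 := ⟨hα.1, hα.2.trans hW.lt_one⟩
  rw [hW.value_eq α hα1]
  rcases lt_or_ge α M.cutPF with h | h
  · linarith [hM.lt_cutPF_iff.1 h, le_max_right (M.g * α) M.s,
      hM.phi_nonneg (M.reportValue W W' α)]
  · linarith [le_max_left (M.g * α) M.s,
      hM.phi_pos (hW.reportValue_pos α ⟨hM.cutSP_lt_cutPF.trans_le h, hα.2⟩)]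

end IsCandidate

/-! ### Plans -/

theorem Plan.H_nonneg (P : M.Plan) (hM : M.Standing) (t : ℝ) : 0 ≤ M.H (P.act t).bonus :=
  hM.H_nonneg (P.feasible t)

theorem Plan.H_le_one (P : M.Plan) (hM : M.Standing) (t : ℝ) : M.H (P.act t).bonus ≤ 1 :=
  hM.H_le_one (P.feasible t)

theorem Plan.H_measurable (P : M.Plan) (hM : M.Standing) :
    Measurable fun t => M.H (P.act t).bonus := by
  have h1 : Continuous (IccExtend hM.cbar_pos.le ((Icc 0 M.cbar).domRestrict M.H)) :=
    hM.H_continuousOn.domRestrict.Icc_extend'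
  have h2 : (fun t => M.H (P.act t).bonus) =
      IccExtend hM.cbar_pos.le ((Icc 0 M.cbar).domRestrict M.H) ∘ fun t => (P.act t).bonus := by
    funext t
    exact (IccExtend_of_mem hM.cbar_pos.le ((Icc 0 M.cbar).domRestrict M.H) (P.feasible t)).symm
  rw [h2]
  exact h1.measurable.comp P.bonus_measurable

theorem Plan.H_intervalIntegrable (P : M.Plan) (hM : M.Standing) (a b : ℝ) :
    IntervalIntegrable (fun t => M.H (P.act t).bonus) volume a b := by
  refine (intervalIntegrable_const (c := (1 : ℝ))).mono_fun
    (P.H_measurable hM).aestronglyMeasurable (Eventually.of_forall fun t => ?_)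
  dsimp only
  rw [Real.norm_of_nonneg (P.H_nonneg hM t), norm_one]
  exact P.H_le_one hM t

theorem Plan.reports_lipschitz (P : M.Plan) (hM : M.Standing) : LipschitzWith 1 P.reports := by
  refine LipschitzWith.of_dist_le_mul fun x y => ?_
  rw [Real.dist_eq, Real.dist_eq, NNReal.coe_one, one_mul, reports, reports,
    intervalIntegral.integral_interval_sub_left (P.H_intervalIntegrable hM _ _)
      (P.H_intervalIntegrable hM _ _)]
  have := intervalIntegral.norm_integral_le_of_norm_le_const (a := y) (b := x) (C := 1)
    (f := fun t => M.H (P.act t).bonus) fun t _ => by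
      rw [Real.norm_of_nonneg (P.H_nonneg hM t)]
      exact P.H_le_one hM t
  rwa [one_mul] at this

theorem Plan.ae_hasDerivAt_reports (P : M.Plan) (hM : M.Standing) :
    ∀ᵐ t, HasDerivAt P.reports (M.H (P.act t).bonus) t := by
  have h : LocallyIntegrable (fun t => M.H (P.act t).bonus) volume :=
    (locallyIntegrable_const (1 : ℝ)).mono (P.H_measurable hM).aestronglyMeasurable
      (Eventually.of_forall fun t => by
        rw [Real.norm_of_nonneg (P.H_nonneg hM t), norm_one]
        exact P.H_le_one hM t)
  filter_upwards [LocallyIntegrable.ae_hasDerivAt_integral h] with t ht using ht 0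

/-! ### Bayesian updating in terms of accumulated reports -/

/-- The probability of no good news after the amount `R` of reports. -/
noncomputable def noNewsAt (M : Market) (α₀ R : ℝ) : ℝ := α₀ * Real.exp (-M.lam * R) + (1 - α₀)

/-- The belief after the amount `R` of reports without good news. -/
noncomputable def beliefAt (M : Market) (α₀ R : ℝ) : ℝ :=
  α₀ * Real.exp (-M.lam * R) / M.noNewsAt α₀ R

theorem Plan.noNews_eq (P : M.Plan) (α₀ t : ℝ) : P.noNews α₀ t = M.noNewsAt α₀ (P.reports t) := rfl

theorem Plan.belief_eq (P : M.Plan) (α₀ t : ℝ) : P.belief α₀ t = M.beliefAt α₀ (P.reports t) := rfl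

section Dynamics

variable {α₀ : ℝ}

theorem noNewsAt_pos (hα₀ : α₀ ∈ Ioo (0 : ℝ) 1) (R : ℝ) : 0 < M.noNewsAt α₀ R :=
  add_pos (mul_pos hα₀.1 (Real.exp_pos _)) (sub_pos.2 hα₀.2)

theorem noNewsAt_le_one (hα₀ : α₀ ∈ Ioo (0 : ℝ) 1) (hM : M.Standing) {R : ℝ} (hR : 0 ≤ R) :
    M.noNewsAt α₀ R ≤ 1 := by
  have h1 : Real.exp (-M.lam * R) ≤ 1 :=
    Real.exp_le_one_iff.2 (by have := mul_nonneg hM.lam_pos.le hR; linarith)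
  have := mul_le_of_le_one_right hα₀.1.le h1
  unfold noNewsAt
  linarith

theorem noNewsAt_mul_beliefAt (hα₀ : α₀ ∈ Ioo (0 : ℝ) 1) (R : ℝ) :
    M.noNewsAt α₀ R * M.beliefAt α₀ R = α₀ * Real.exp (-M.lam * R) :=
  mul_div_cancel₀ _ (noNewsAt_pos hα₀ R).ne'

theorem beliefAt_mem (hα₀ : α₀ ∈ Ioo (0 : ℝ) 1) (R : ℝ) : M.beliefAt α₀ R ∈ Ioo (0 : ℝ) 1 := by
  refine ⟨div_pos (mul_pos hα₀.1 (Real.exp_pos _)) (noNewsAt_pos hα₀ R), ?_⟩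
  rw [beliefAt, div_lt_one (noNewsAt_pos hα₀ R), noNewsAt]
  linarith [hα₀.2]

theorem beliefAt_zero (α₀ : ℝ) : M.beliefAt α₀ 0 = α₀ := by
  simp [beliefAt, noNewsAt]

theorem hasDerivAt_noNewsAt (hα₀ : α₀ ∈ Ioo (0 : ℝ) 1) (R : ℝ) :
    HasDerivAt (M.noNewsAt α₀) (-M.lam * (M.noNewsAt α₀ R * M.beliefAt α₀ R)) R := by
  rw [noNewsAt_mul_beliefAt hα₀]
  have h : HasDerivAt (fun R => -M.lam * R) (-M.lam * 1) R := (hasDerivAt_id R).const_mul _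
  exact ((h.exp.const_mul α₀).add_const (1 - α₀)).congr_deriv (by ring)

theorem hasDerivAt_beliefAt (hα₀ : α₀ ∈ Ioo (0 : ℝ) 1) (R : ℝ) : HasDerivAt (M.beliefAt α₀)
    (-M.lam * (M.beliefAt α₀ R * (1 - M.beliefAt α₀ R))) R := by
  have h : HasDerivAt (fun R => -M.lam * R) (-M.lam * 1) R := (hasDerivAt_id R).const_mul _
  have hn := (noNewsAt_pos (M := M) hα₀ R).ne'
  refine ((h.exp.const_mul α₀).div (hasDerivAt_noNewsAt hα₀ R) hn).congr_deriv ?_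
  have e : α₀ * (Real.exp (-M.lam * R) * (-M.lam * 1)) =
      -M.lam * (M.noNewsAt α₀ R * M.beliefAt α₀ R) := by
    rw [noNewsAt_mul_beliefAt hα₀]; ring
  rw [e, ← noNewsAt_mul_beliefAt hα₀]
  field_simp
  ring

theorem continuous_beliefAt (hα₀ : α₀ ∈ Ioo (0 : ℝ) 1) : Continuous (M.beliefAt α₀) :=
  continuous_iff_continuousAt.2 fun R => (hasDerivAt_beliefAt hα₀ R).continuousAt

theorem continuous_noNewsAt (hα₀ : α₀ ∈ Ioo (0 : ℝ) 1) : Continuous (M.noNewsAt α₀) :=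
  continuous_iff_continuousAt.2 fun R => (hasDerivAt_noNewsAt hα₀ R).continuousAt

end Dynamics

variable {M : Market} {W W' : ℝ → ℝ} {αFN α₀ : ℝ}

theorem Plan.reports_nonneg (P : M.Plan) (hM : M.Standing) {t : ℝ} (ht : 0 ≤ t) :
    0 ≤ P.reports t :=
  intervalIntegral.integral_nonneg ht fun u _ => P.H_nonneg hM u

theorem Plan.belief_mem (P : M.Plan) (hα₀ : α₀ ∈ Ioo (0 : ℝ) 1) (t : ℝ) :
    P.belief α₀ t ∈ Ioo (0 : ℝ) 1 :=
  beliefAt_mem hα₀ _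

theorem Plan.belief_continuous (P : M.Plan) (hM : M.Standing) (hα₀ : α₀ ∈ Ioo (0 : ℝ) 1) :
    Continuous (P.belief α₀) :=
  (continuous_beliefAt hα₀).comp (P.reports_lipschitz hM).continuous

theorem Plan.noNews_continuous (P : M.Plan) (hM : M.Standing) (hα₀ : α₀ ∈ Ioo (0 : ℝ) 1) :
    Continuous (P.noNews α₀) :=
  (continuous_noNewsAt hα₀).comp (P.reports_lipschitz hM).continuous

theorem Plan.noNews_mem (P : M.Plan) (hM : M.Standing) (hα₀ : α₀ ∈ Ioo (0 : ℝ) 1) {t : ℝ}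
    (ht : 0 ≤ t) : P.noNews α₀ t ∈ Ioc (0 : ℝ) 1 :=
  ⟨noNewsAt_pos hα₀ _, noNewsAt_le_one hα₀ hM (P.reports_nonneg hM ht)⟩

/-- Bounded measurable flows, discounted and weighted with the probability of no news, are
integrable. -/
theorem Plan.integrableOn_discounted (P : M.Plan) (hM : M.Standing) (hα₀ : α₀ ∈ Ioo (0 : ℝ) 1)
    {f : ℝ → ℝ} (hf : Measurable f) {C : ℝ} (hC : ∀ t, |f t| ≤ C) :
    IntegrableOn (fun t => Real.exp (-M.r * t) * P.noNews α₀ t * f t) (Ioi 0) := by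
  refine ((exp_neg_integrableOn_Ioi 0 hM.r_pos).const_mul C).mono' ?_ ?_
  · refine (((by fun_prop : Measurable fun t : ℝ => Real.exp (-M.r * t)).mul
      (P.noNews_continuous hM hα₀).measurable).mul hf).aestronglyMeasurable
  · filter_upwards [ae_restrict_mem measurableSet_Ioi] with t ht
    obtain ⟨h1, h2⟩ := P.noNews_mem hM hα₀ (le_of_lt ht)
    rw [norm_mul, norm_mul, Real.norm_of_nonneg (Real.exp_pos _).le, Real.norm_of_nonneg h1.le,
      Real.norm_eq_abs]
    have h3 := mul_le_mul h2 (hC t) (abs_nonneg _) zero_le_one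
    have h4 := mul_le_mul_of_nonneg_left h3 (Real.exp_pos (-M.r * t)).le
    linarith

theorem abs_flow_le (hM : M.Standing) {α : ℝ} (hα : α ∈ Ioo (0 : ℝ) 1) {a : StageAction}
    (ha : M.Feasible a) : |M.flow α a| ≤ M.g + M.cbar + M.s := by
  have hb0 : 0 ≤ a.bonus := ha.1
  have hb1 : a.bonus ≤ M.cbar := ha.2
  have hH0 := hM.H_nonneg ha
  have hH1 := hM.H_le_one ha
  have hs := hM.s_pos
  have hga : M.lam * α * M.z = M.g * α := by unfold g; ring
  have hg0 : 0 ≤ M.g * α := mul_nonneg hM.g_pos.le hα.1.le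
  have hg1 : M.g * α ≤ M.g := mul_le_of_le_one_right hM.g_pos.le hα.2.le
  have h1 : M.H a.bonus * a.bonus ≤ M.cbar := by
    have := mul_le_mul hH1 hb1 hb0 zero_le_one
    linarith
  have h2 : 0 ≤ M.H a.bonus * a.bonus := mul_nonneg hH0 hb0
  have h3 : M.H a.bonus * (M.g * α) ≤ M.g := (mul_le_of_le_one_left hg0 hH1).trans hg1
  have h4 : 0 ≤ M.H a.bonus * (M.g * α) := mul_nonneg hH0 hg0
  have h5 : 0 ≤ (1 - M.H a.bonus) * M.s := mul_nonneg (by linarith) hs.le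
  have h6 : (1 - M.H a.bonus) * M.s ≤ M.s := mul_le_of_le_one_left hs.le (by linarith)
  rcases a with ⟨ℓ, b⟩
  cases ℓ <;> simp only [flow, hga] <;> simp only at h1 h2 h3 h4 h5 h6
  · exact abs_le.2 ⟨by linarith [hM.g_pos], by linarith⟩
  · rw [mul_sub]
    exact abs_le.2 ⟨by linarith [hM.g_pos], by linarith⟩

theorem Plan.flow_measurable (P : M.Plan) (hM : M.Standing) (hα₀ : α₀ ∈ Ioo (0 : ℝ) 1) :
    Measurable fun t => M.flow (P.belief α₀ t) (P.act t) := by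
  classical
  have hH := P.H_measurable hM
  have hb := P.bonus_measurable
  have hα := (P.belief_continuous hM hα₀).measurable
  have h : (fun t => M.flow (P.belief α₀ t) (P.act t)) = fun t =>
      if (P.act t).arm = Arm.risky then
        M.lam * P.belief α₀ t * M.z - M.H (P.act t).bonus * (P.act t).bonus
      else M.H (P.act t).bonus * (M.lam * P.belief α₀ t * M.z - (P.act t).bonus) +
        (1 - M.H (P.act t).bonus) * M.s := by
    funext t
    cases hℓ : (P.act t).arm <;> simp [flow, hℓ]
  rw [h]
  refine Measurable.ite P.arm_measurable ?_ ?_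
  · exact ((hα.const_mul _).mul_const _).sub (hH.mul hb)
  · exact (hH.mul (((hα.const_mul _).mul_const _).sub hb)).add ((hH.const_sub 1).mul_const _)

/-! ### Verification: profit as candidate value minus accumulated shortfall -/

/-- The shortfall of a plan from the Bellman equation at time `t`, in present value. -/
noncomputable def Plan.shortfall (P : M.Plan) (W : ℝ → ℝ) (α₀ t : ℝ) : ℝ :=
  Real.exp (-M.r * t) * P.noNews α₀ t *
    (M.r * W (P.belief α₀ t) - M.bellman W (P.belief α₀ t) (P.act t))

/-- The drift of the value along a plan. -/
noncomputable def Plan.drift (P : M.Plan) (W W' : ℝ → ℝ) (α₀ t : ℝ) : ℝ :=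
  -M.r * W (P.belief α₀ t) + M.H (P.act t).bonus *
    (-M.lam * P.belief α₀ t * (W (P.belief α₀ t) + (1 - P.belief α₀ t) * W' (P.belief α₀ t)))

theorem IsCandidate.hasDerivAt_weighted (hW : M.IsCandidate W W' αFN) (hα₀ : α₀ ∈ Ioo (0 : ℝ) 1)
    (R : ℝ) : HasDerivAt (fun R => M.noNewsAt α₀ R * W (M.beliefAt α₀ R))
      (M.noNewsAt α₀ R * (-M.lam * M.beliefAt α₀ R *
        (W (M.beliefAt α₀ R) + (1 - M.beliefAt α₀ R) * W' (M.beliefAt α₀ R)))) R := by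
  have h1 := (hW.hasDerivAt _ (beliefAt_mem (M := M) hα₀ R)).comp R (hasDerivAt_beliefAt hα₀ R)
  exact ((hasDerivAt_noNewsAt hα₀ R).mul h1).congr_deriv (by simp only [Function.comp]; ring)

theorem IsCandidate.continuousOn (hW : M.IsCandidate W W' αFN) : ContinuousOn W (Ioo 0 1) :=
  fun α hα => (hW.hasDerivAt α hα).continuousAt.continuousWithinAt

theorem IsCandidate.drift_measurable (hW : M.IsCandidate W W' αFN) (hM : M.Standing)
    (hα₀ : α₀ ∈ Ioo (0 : ℝ) 1) (P : M.Plan) : Measurable (P.drift W W' α₀) := by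
  have hα := P.belief_continuous hM hα₀
  have h1 : Measurable fun t => W (P.belief α₀ t) :=
    (hW.continuousOn.comp_continuous hα (P.belief_mem hα₀)).measurable
  have h2 : Measurable fun t => W' (P.belief α₀ t) :=
    (hW.deriv_continuousOn.comp_continuous hα (P.belief_mem hα₀)).measurable
  exact (h1.const_mul _).add ((P.H_measurable hM).mul ((hα.measurable.const_mul _).mul
    (h1.add ((hα.measurable.const_sub 1).mul h2))))

theorem IsCandidate.exists_bound (hW : M.IsCandidate W W' αFN) (hM : M.Standing) :
    ∃ C, 0 ≤ C ∧ (∀ α ∈ Ioo (0 : ℝ) 1, |W α| ≤ C) ∧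
      ∀ α ∈ Ioo (0 : ℝ) 1, |(-M.lam * α * (W α + (1 - α) * W' α))| ≤ C := by
  obtain ⟨C, hC⟩ := hW.bounded
  have hl := hM.lam_pos
  have hC0 : 0 ≤ C := (abs_nonneg _).trans (hC (1 / 2) ⟨by norm_num, by norm_num⟩).1
  refine ⟨max C (M.lam * (C + C)), le_max_of_le_left hC0,
    fun α hα => (hC α hα).1.trans (le_max_left _ _), fun α hα => le_trans ?_ (le_max_right _ _)⟩
  obtain ⟨h1, h2⟩ := hC α hα
  have h3 : |(1 - α) * W' α| ≤ C := by
    rw [abs_mul, abs_of_pos (sub_pos.2 hα.2)]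
    exact (mul_le_of_le_one_left (abs_nonneg _) (by linarith [hα.1])).trans h2
  have h4 : |W α + (1 - α) * W' α| ≤ C + C := (abs_add_le _ _).trans (add_le_add h1 h3)
  rw [abs_mul, abs_mul, abs_neg, abs_of_pos hl, abs_of_pos hα.1]
  exact mul_le_mul (mul_le_of_le_one_right hl.le hα.2.le) h4 (abs_nonneg _) hl.le

theorem IsCandidate.integrableOn_drift (hW : M.IsCandidate W W' αFN) (hM : M.Standing)
    (hα₀ : α₀ ∈ Ioo (0 : ℝ) 1) (P : M.Plan) : IntegrableOn (fun t =>
      Real.exp (-M.r * t) * P.noNews α₀ t * P.drift W W' α₀ t) (Ioi 0) := by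
  obtain ⟨C, hC0, h1, h2⟩ := hW.exists_bound hM
  refine P.integrableOn_discounted hM hα₀ (hW.drift_measurable hM hα₀ P) (C := M.r * C + C)
    fun t => ?_
  have hα := P.belief_mem hα₀ t
  refine (abs_add_le _ _).trans (add_le_add ?_ ?_)
  · rw [abs_mul, abs_neg, abs_of_pos hM.r_pos]
    exact mul_le_mul_of_nonneg_left (h1 _ hα) hM.r_pos.le
  · rw [abs_mul, abs_of_nonneg (P.H_nonneg hM t)]
    exact (mul_le_of_le_one_left (abs_nonneg _) (P.H_le_one hM t)).trans (h2 _ hα)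

/-- This is the fundamental theorem of calculus for the discounted, no-news-weighted value Φ. The
controls are only measurable, so Φ is differentiable only almost everywhere, but it is absolutely
continuous on bounded intervals; boundedness of W and discounting send it to zero. -/
theorem IsCandidate.integral_drift (hW : M.IsCandidate W W' αFN) (hM : M.Standing)
    (hα₀ : α₀ ∈ Ioo (0 : ℝ) 1) (P : M.Plan) :
    ∫ t in Ioi (0 : ℝ), Real.exp (-M.r * t) * P.noNews α₀ t * P.drift W W' α₀ t = -W α₀ := by
  obtain ⟨C, hC0, h1, h2⟩ := hW.exists_bound hM
  set A : ℝ → ℝ := fun R => M.noNewsAt α₀ R * W (M.beliefAt α₀ R) with hA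
  set Φ : ℝ → ℝ := fun t => Real.exp (-M.r * t) * A (P.reports t) with hΦ
  have hAd := hW.hasDerivAt_weighted (M := M) hα₀
  have hnonneg : ∀ T, 0 ≤ T → ∀ t ∈ uIcc 0 T, 0 ≤ P.reports t := fun T hT t ht => by
    rw [uIcc_of_le hT] at ht
    exact P.reports_nonneg hM ht.1
  -- Only nonnegative report amounts are admitted, since the weight is at most one only there.
  have hAlip : LipschitzOnWith (Real.toNNReal C) A (Ici 0) := by
    refine Convex.lipschitzOnWith_of_nnnorm_hasDerivWithin_le (convex_Ici 0)
      (fun R _ => (hAd R).hasDerivWithinAt) fun R hR => ?_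
    rw [← NNReal.coe_le_coe, coe_nnnorm, Real.coe_toNNReal _ hC0, norm_mul,
      Real.norm_of_nonneg (noNewsAt_pos hα₀ R).le, Real.norm_eq_abs]
    exact (mul_le_of_le_one_left (abs_nonneg _) (noNewsAt_le_one hα₀ hM hR)).trans
      (h2 _ (beliefAt_mem hα₀ R))
  have hΦd : ∀ᵐ t, HasDerivAt Φ (Real.exp (-M.r * t) * P.noNews α₀ t * P.drift W W' α₀ t) t := by
    filter_upwards [P.ae_hasDerivAt_reports hM] with t ht
    have e1 : HasDerivAt (fun t => -M.r * t) (-M.r * 1) t := (hasDerivAt_id t).const_mul _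
    refine (e1.exp.mul ((hAd (P.reports t)).comp t ht)).congr_deriv ?_
    simp only [Function.comp, Plan.drift, P.noNews_eq, P.belief_eq]
    ring
  have hFTC : ∀ T, 0 ≤ T → ∫ t in (0 : ℝ)..T, Real.exp (-M.r * t) * P.noNews α₀ t *
      P.drift W W' α₀ t = Φ T - W α₀ := by
    intro T hT
    have hac : AbsolutelyContinuousOnInterval Φ 0 T := by
      refine AbsolutelyContinuousOnInterval.mul
        (ContDiffOn.absolutelyContinuousOnInterval (by fun_prop)) ?_
      exact (hAlip.comp (P.reports_lipschitz hM).lipschitzOnWith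
        (hnonneg T hT)).absolutelyContinuousOnInterval
    have hΦ0 : Φ 0 = W α₀ := by
      simp [hΦ, hA, Plan.reports, beliefAt_zero, noNewsAt]
    rw [← hΦ0, ← hac.integral_deriv_eq_sub]
    refine intervalIntegral.integral_congr_ae ?_
    filter_upwards [hΦd] with t ht _ using ht.deriv.symm
  have hlim1 := intervalIntegral_tendsto_integral_Ioi 0 (hW.integrableOn_drift hM hα₀ P) tendsto_id
  have hlim2 : Tendsto Φ atTop (𝓝 0) := by
    have h3 : Tendsto (fun t => C * Real.exp (-M.r * t)) atTop (𝓝 0) := by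
      have := Real.tendsto_exp_neg_atTop_nhds_zero.comp (tendsto_id.const_mul_atTop hM.r_pos)
      simpa [Function.comp_def] using this.const_mul C
    refine squeeze_zero_norm' ?_ h3
    filter_upwards [eventually_ge_atTop 0] with t ht
    have h4 := P.noNews_mem hM hα₀ ht
    rw [hΦ, norm_mul, norm_mul, Real.norm_of_nonneg (Real.exp_pos _).le, mul_comm C]
    refine mul_le_mul_of_nonneg_left ?_ (Real.exp_pos _).le
    rw [← P.noNews_eq, Real.norm_of_nonneg h4.1.le, Real.norm_eq_abs]
    exact (mul_le_of_le_one_left (abs_nonneg _) h4.2).trans (h1 _ (beliefAt_mem hα₀ _))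
  refine tendsto_nhds_unique hlim1 ?_
  have h5 : Tendsto (fun T => Φ T - W α₀) atTop (𝓝 (0 - W α₀)) := hlim2.sub_const _
  rw [zero_sub] at h5
  refine h5.congr' ?_
  filter_upwards [eventually_ge_atTop 0] with T hT using (hFTC T hT).symm

theorem Plan.integrableOn_profit (P : M.Plan) (hM : M.Standing) (hα₀ : α₀ ∈ Ioo (0 : ℝ) 1) :
    IntegrableOn (fun t => Real.exp (-M.r * t) * P.noNews α₀ t *
      (M.flow (P.belief α₀ t) (P.act t) +
        M.H (P.act t).bonus * (P.belief α₀ t * M.lam) * (M.lam * M.z / M.r))) (Ioi 0) := by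
  have hg : 0 ≤ M.lam * M.z / M.r := (div_pos hM.g_pos hM.r_pos).le
  refine P.integrableOn_discounted hM hα₀ ((P.flow_measurable hM hα₀).add
    (((P.H_measurable hM).mul ((P.belief_continuous hM hα₀).measurable.mul_const _)).mul_const _))
    (C := M.g + M.cbar + M.s + M.lam * (M.lam * M.z / M.r)) fun t => ?_
  have hα := P.belief_mem hα₀ t
  refine (abs_add_le _ _).trans (add_le_add (abs_flow_le hM hα (P.feasible t)) ?_)
  have h1 : 0 ≤ P.belief α₀ t * M.lam := mul_nonneg hα.1.le hM.lam_pos.le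
  have h2 : P.belief α₀ t * M.lam ≤ M.lam := mul_le_of_le_one_left hM.lam_pos.le hα.2.le
  rw [abs_of_nonneg (mul_nonneg (mul_nonneg (P.H_nonneg hM t) h1) hg)]
  exact mul_le_mul_of_nonneg_right
    ((mul_le_of_le_one_left h1 (P.H_le_one hM t)).trans h2) hg

theorem IsCandidate.shortfall_eq (hW : M.IsCandidate W W' αFN) (hα₀ : α₀ ∈ Ioo (0 : ℝ) 1)
    (P : M.Plan) (t : ℝ) : P.shortfall W α₀ t =
      -(Real.exp (-M.r * t) * P.noNews α₀ t * P.drift W W' α₀ t) -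
        Real.exp (-M.r * t) * P.noNews α₀ t * (M.flow (P.belief α₀ t) (P.act t) +
          M.H (P.act t).bonus * (P.belief α₀ t * M.lam) * (M.lam * M.z / M.r)) := by
  rw [Plan.shortfall, Plan.drift, bellman, (hW.hasDerivAt _ (P.belief_mem hα₀ t)).deriv]
  ring

theorem IsCandidate.integrableOn_shortfall (hW : M.IsCandidate W W' αFN) (hM : M.Standing)
    (hα₀ : α₀ ∈ Ioo (0 : ℝ) 1) (P : M.Plan) : IntegrableOn (P.shortfall W α₀) (Ioi 0) := by
  rw [show P.shortfall W α₀ = _ from funext (hW.shortfall_eq hα₀ P)]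
  exact (hW.integrableOn_drift hM hα₀ P).neg.sub (P.integrableOn_profit hM hα₀)

/-- The profit of a plan falls short of the candidate by the accumulated shortfall from the Bellman
equation. -/
theorem IsCandidate.profit_eq (hW : M.IsCandidate W W' αFN) (hM : M.Standing)
    (hα₀ : α₀ ∈ Ioo (0 : ℝ) 1) (P : M.Plan) :
    P.profit α₀ = W α₀ - ∫ t in Ioi (0 : ℝ), P.shortfall W α₀ t := by
  have h1 : ∫ t in Ioi (0 : ℝ), P.shortfall W α₀ t = -(-W α₀) - P.profit α₀ := by
    rw [← hW.integral_drift hM hα₀ P, Plan.profit, ← integral_neg]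
    exact (integral_congr_ae (Eventually.of_forall (hW.shortfall_eq hα₀ P))).trans
      (integral_sub (hW.integrableOn_drift hM hα₀ P).neg (P.integrableOn_profit hM hα₀))
  linarith

theorem IsCandidate.shortfall_nonneg (hW : M.IsCandidate W W' αFN) (hM : M.Standing)
    (hα₀ : α₀ ∈ Ioo (0 : ℝ) 1) (P : M.Plan) (t : ℝ) : 0 ≤ P.shortfall W α₀ t :=
  mul_nonneg (mul_pos (Real.exp_pos _) (noNewsAt_pos hα₀ _)).le
    (sub_nonneg.2 (hW.bellman_le hM (P.belief_mem hα₀ t) (P.feasible t)))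

theorem IsCandidate.profit_le (hW : M.IsCandidate W W' αFN) (hM : M.Standing)
    (hα₀ : α₀ ∈ Ioo (0 : ℝ) 1) (P : M.Plan) : P.profit α₀ ≤ W α₀ := by
  rw [hW.profit_eq hM hα₀ P]
  have := setIntegral_nonneg (μ := volume) (measurableSet_Ioi (a := (0 : ℝ)))
    fun t _ => hW.shortfall_nonneg hM hα₀ P t
  linarith

/-- Plans that attain the candidate solve the Bellman equation almost always. -/
theorem IsCandidate.ae_bellman_eq (hW : M.IsCandidate W W' αFN) (hM : M.Standing)
    (hα₀ : α₀ ∈ Ioo (0 : ℝ) 1) {P : M.Plan} (hP : P.profit α₀ = W α₀) :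
    ∀ᵐ t ∂(volume.restrict (Ioi (0 : ℝ))),
      M.bellman W (P.belief α₀ t) (P.act t) = M.r * W (P.belief α₀ t) := by
  have h1 : ∫ t in Ioi (0 : ℝ), P.shortfall W α₀ t = 0 := by
    linarith [hW.profit_eq hM hα₀ P]
  have h2 := (integral_eq_zero_iff_of_nonneg (hW.shortfall_nonneg hM hα₀ P)
    (hW.integrableOn_shortfall hM hα₀ P)).1 h1
  filter_upwards [h2] with t ht
  have h3 := (mul_eq_zero.1 ht).resolve_left
    (mul_pos (Real.exp_pos _) (noNewsAt_pos (M := M) hα₀ _)).ne'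
  linarith

variable {M : Market} {W W' : ℝ → ℝ} {αFN α₀ : ℝ}

/-! ### The optimal policy -/

/-- The policy that promotes the better arm and pays the best bonus. -/
noncomputable def policy (M : Market) (W W' : ℝ → ℝ) (α : ℝ) : StageAction :=
  open Classical in
  ⟨if M.cutPF ≤ α then Arm.risky else Arm.safe, M.bestBonus (M.reportValue W W' α)⟩

theorem Standing.armLoss_risky (hM : M.Standing) {α : ℝ} (h : M.cutPF ≤ α) :
    M.armLoss α Arm.risky = 0 := by
  rw [armLoss, max_eq_left (hM.cutPF_le_iff.1 h), sub_self]

theorem Standing.armLoss_safe (hM : M.Standing) {α : ℝ} (h : α ≤ M.cutPF) :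
    M.armLoss α Arm.safe = 0 := by
  have h1 := mul_le_mul_of_nonneg_left h hM.g_pos.le
  have h2 : M.g * M.cutPF = M.s := mul_div_cancel₀ _ hM.g_pos.ne'
  rw [armLoss, max_eq_right (by linarith), sub_self]

theorem policy_feasible (hM : M.Standing) (α : ℝ) : M.Feasible (M.policy W W' α) :=
  hM.bestBonus_mem _

theorem IsCandidate.bellman_policy (hW : M.IsCandidate W W' αFN) (hM : M.Standing) {α : ℝ}
    (hα : α ∈ Ioo (0 : ℝ) 1) : M.bellman W α (M.policy W W' α) = M.r * W α := by
  refine hW.bellman_attained hα ?_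
  split_ifs with h
  · exact hM.armLoss_risky h
  · exact hM.armLoss_safe (not_le.1 h).le

theorem IsCandidate.bonus_continuous (hW : M.IsCandidate W W' αFN) (hM : M.Standing)
    (hα₀ : α₀ ∈ Ioo (0 : ℝ) 1) :
    Continuous fun R => M.bestBonus (M.reportValue W W' (M.beliefAt α₀ R)) := by
  have hy : ContinuousOn (M.reportValue W W') (Ioo 0 1) := by
    have h1 := hW.continuousOn
    have h2 := hW.deriv_continuousOn
    unfold reportValue
    fun_prop
  have hy' : Continuous fun R => M.reportValue W W' (M.beliefAt α₀ R) :=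
    hy.comp_continuous (continuous_beliefAt hα₀) (beliefAt_mem hα₀)
  exact continuous_iff_continuousAt.2 fun R => ContinuousAt.comp
    (f := fun R => M.reportValue W W' (M.beliefAt α₀ R)) (g := M.bestBonus)
    (hM.bestBonus_continuousAt (hW.reportValue_lt _ (beliefAt_mem hα₀ R))) hy'.continuousAt

/-- The policy can be followed from every prior. -/
theorem IsCandidate.exists_plan (hW : M.IsCandidate W W' αFN) (hM : M.Standing)
    (hα₀ : α₀ ∈ Ioo (0 : ℝ) 1) :
    ∃ P : M.Plan, ∀ t, 0 ≤ t → P.act t = M.policy W W' (P.belief α₀ t) := by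
  have hb := hW.bonus_continuous hM hα₀
  have hmem := fun R => hM.bestBonus_mem (M.reportValue W W' (M.beliefAt α₀ R))
  -- The belief depends on time only through accumulated reports, so following the policy means R' =
  -- H(bonus at the belief after R). The right-hand side may vanish and need not be Lipschitz.
  obtain ⟨R, hRc, hR⟩ := exists_solution_of_autonomous
    (hM.H_continuousOn.comp_continuous hb hmem) (fun x => hM.H_nonneg (hmem x))
    (fun x => hM.H_le_one (hmem x))
  -- Resolving the tie at the myopic cutoff in favour of the risky arm makes this set closed, hence
  -- measurable.
  have harm : {t | (M.policy W W' (M.beliefAt α₀ (R t))).arm = Arm.risky} =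
      {t | M.cutPF ≤ M.beliefAt α₀ (R t)} := by
    ext t
    simp only [policy, mem_ofPred_eq]
    split_ifs with h <;> simp [h]
  let P : M.Plan :=
    { act := fun t => M.policy W W' (M.beliefAt α₀ (R t))
      arm_measurable := by
        rw [harm]
        exact (isClosed_le continuous_const
          ((continuous_beliefAt hα₀).comp hRc)).measurableSet
      bonus_measurable := (hb.comp hRc).measurable
      feasible := fun t => policy_feasible hM _ }
  refine ⟨P, fun t ht => ?_⟩
  have h : P.reports t = R t := (hR t ht).symm
  rw [P.belief_eq, h]

theorem IsCandidate.profit_of_policy (hW : M.IsCandidate W W' αFN) (hM : M.Standing)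
    (hα₀ : α₀ ∈ Ioo (0 : ℝ) 1) {P : M.Plan}
    (hP : ∀ t, 0 ≤ t → P.act t = M.policy W W' (P.belief α₀ t)) : P.profit α₀ = W α₀ := by
  rw [hW.profit_eq hM hα₀ P, setIntegral_eq_zero_of_forall_eq_zero, sub_zero]
  intro t ht
  rw [Plan.shortfall, hP t (le_of_lt ht), hW.bellman_policy hM (P.belief_mem hα₀ t), sub_self,
    mul_zero]

/-! ### The value function -/

theorem IsCandidate.value_eq_on (hW : M.IsCandidate W W' αFN) (hM : M.Standing) :
    EqOn M.value W (Ioo 0 1) := by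
  intro α hα
  obtain ⟨P, hP⟩ := hW.exists_plan hM hα
  have : Nonempty M.Plan := ⟨P⟩
  refine le_antisymm (ciSup_le fun Q => hW.profit_le hM hα Q) ?_
  rw [← hW.profit_of_policy hM hα hP]
  exact le_ciSup (f := fun Q : M.Plan => Q.profit α)
    ⟨W α, by rintro _ ⟨Q, rfl⟩; exact hW.profit_le hM hα Q⟩ P

/-- All properties concern beliefs in the open unit interval, so they pass from the ODE solution to
the value function itself, whatever the values outside. -/
theorem IsCandidate.congr (hW : M.IsCandidate W W' αFN) (hM : M.Standing) {V : ℝ → ℝ}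
    (hV : EqOn V W (Ioo 0 1)) : M.IsCandidate V W' αFN := by
  have hy : ∀ α ∈ Ioo (0 : ℝ) 1, M.reportValue V W' α = M.reportValue W W' α := fun α hα => by
    rw [reportValue, reportValue, hV hα]
  have hPQ := hM.cutSP_lt_cutPF
  have hN := hW.cutPF_lt
  have hN1 := hW.lt_one
  have hP := hM.cutSP_pos
  refine ⟨fun α hα => (hW.hasDerivAt α hα).congr_of_eventuallyEq
    (hV.eventuallyEq_of_mem (Ioo_mem_nhds hα.1 hα.2)), hW.deriv_continuousOn, ?_, hN, hN1,
    fun α hα => ?_, fun α hα => ?_, fun α hα => ?_, fun α hα => ?_, fun α hα => ?_,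
    fun α hα => ?_, fun α hα => ?_⟩
  · obtain ⟨C, hC⟩ := hW.bounded
    exact ⟨C, fun α hα => by rw [hV hα]; exact hC α hα⟩
  · rw [hV ⟨hα.1, by linarith [hα.2]⟩, hW.eq_safe α hα]
  · rw [hV ⟨by linarith [hα.1], hα.2⟩, hW.eq_risky α hα]
  · rw [hy α hα, hV hα, hW.value_eq α hα]
  · rw [hy α hα]
    exact hW.reportValue_lt α hα
  · rw [hy α ⟨hα.1, by linarith [hα.2]⟩]
    exact hW.reportValue_nonpos_left α hα
  · rw [hy α ⟨by linarith [hα.1], by linarith [hα.2]⟩]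
    exact hW.reportValue_pos α hα
  · rw [hy α ⟨by linarith [hα.1], hα.2⟩]
    exact hW.reportValue_nonpos_right α hα

theorem IsCandidate.contDiffOn (hW : M.IsCandidate W W' αFN) : ContDiffOn ℝ 1 W (Ioo 0 1) := by
  rw [show (1 : WithTop ℕ∞) = 0 + 1 by rw [zero_add],
    contDiffOn_succ_iff_deriv_of_isOpen isOpen_Ioo]
  refine ⟨fun α hα => (hW.hasDerivAt α hα).differentiableAt.differentiableWithinAt, by simp, ?_⟩
  rw [contDiffOn_zero]
  exact hW.deriv_continuousOn.congr fun α hα => (hW.hasDerivAt α hα).deriv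

theorem IsCandidate.bellman_eq_of_isBellmanOptimal (hW : M.IsCandidate W W' αFN)
    (hM : M.Standing) {α : ℝ} (hα : α ∈ Ioo (0 : ℝ) 1) {a : StageAction}
    (ha : M.IsBellmanOptimal W α a) : M.bellman W α a = M.r * W α :=
  le_antisymm (hW.bellman_le hM hα ha.1)
    (hW.bellman_policy hM hα ▸ ha.2 _ (policy_feasible hM α))

theorem IsCandidate.policy_isBellmanOptimal (hW : M.IsCandidate W W' αFN) (hM : M.Standing)
    {α : ℝ} (hα : α ∈ Ioo (0 : ℝ) 1) : M.IsBellmanOptimal W α (M.policy W W' α) :=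
  ⟨policy_feasible hM α, fun a ha => by
    rw [hW.bellman_policy hM hα]
    exact hW.bellman_le hM hα ha⟩

/-- Optimal plans attain the value function. -/
theorem IsCandidate.profit_eq_of_isOptimal (hW : M.IsCandidate W W' αFN) (hM : M.Standing)
    (hα₀ : α₀ ∈ Ioo (0 : ℝ) 1) {P : M.Plan} (hP : P.IsOptimal α₀) : P.profit α₀ = W α₀ := by
  obtain ⟨Q, hQ⟩ := hW.exists_plan hM hα₀
  exact le_antisymm (hW.profit_le hM hα₀ P) (hW.profit_of_policy hM hα₀ hQ ▸ hP Q)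

end Market

/-! ### The cutoff theorem -/

theorem mainTheorem1 (M : Market) (hM : M.Standing) :
    ∃ αSP αPF αFN : ℝ,
      -- the cutoffs
      αSP = M.s * M.r / (M.lam * (M.g - M.s) + M.r * M.g) ∧
      αPF = M.s / (M.lam * M.z) ∧
      IsLeast {x | x ∈ Ioo (0 : ℝ) 1 ∧ M.value x = x * M.z * M.lam / M.r} αFN ∧
      0 < αSP ∧ αSP < αPF ∧ αPF < αFN ∧ αFN < 1 ∧
      -- the value function: continuously differentiable (also at the cutoffs), a solution of the
      -- Bellman equation, and made of the four branches
      ContDiffOn ℝ 1 M.value (Ioo 0 1) ∧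
      (∀ α ∈ Ioo (0 : ℝ) 1, M.BellmanEq M.value α) ∧
      (∀ α ∈ Ioc 0 αSP, M.value α = M.s / M.r) ∧
      (∀ α ∈ Icc αSP αPF, M.ArmEq Arm.safe M.value α) ∧
      (∀ α ∈ Icc αPF αFN, M.ArmEq Arm.risky M.value α) ∧
      (∀ α ∈ Ico αFN 1, M.value α = α * M.z * M.lam / M.r) ∧
      -- maximizers in the Bellman equation are of the prescribed type
      (∀ α ∈ Ioo (0 : ℝ) 1, ∀ a, M.IsBellmanOptimal M.value α a →
        M.Prescribed αSP αPF αFN α a) ∧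
      -- a policy that selects such maximizers is optimal for the lifetime profit from every prior
      (∃ σ : ℝ → StageAction,
        (∀ α ∈ Ioo (0 : ℝ) 1, M.IsBellmanOptimal M.value α (σ α)) ∧
        ∀ α₀ ∈ Ioo (0 : ℝ) 1, ∃ P : M.Plan,
          (∀ t, 0 ≤ t → P.act t = σ (P.belief α₀ t)) ∧ P.IsOptimal α₀) ∧
      -- every optimal plan uses the prescribed strategy at almost every time
      (∀ α₀ ∈ Ioo (0 : ℝ) 1, ∀ P : M.Plan, P.IsOptimal α₀ →
        ∀ᵐ t ∂(volume.restrict (Ioi (0 : ℝ))),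
          M.Prescribed αSP αPF αFN (P.belief α₀ t) (P.act t)) := by
  obtain ⟨W, W', αFN, hW₀⟩ := hM.exists_isCandidate
  have hW : M.IsCandidate M.value W' αFN := hW₀.congr hM (hW₀.value_eq_on hM)
  have hP := hM.cutSP_pos
  have hPQ := hM.cutSP_lt_cutPF
  have hQN := hW.cutPF_lt
  have hN1 := hW.lt_one
  have hform : ∀ x, M.g * x / M.r = x * M.z * M.lam / M.r := fun x => by
    unfold Market.g; ring
  have hrisky : ∀ α ∈ Ico αFN 1, M.value α = α * M.z * M.lam / M.r := fun α hα => by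
    rw [hW.eq_risky α hα, hform]
  refine ⟨M.cutSP, M.cutPF, αFN, rfl, rfl, ⟨⟨⟨by linarith, hN1⟩, hrisky αFN ⟨le_rfl, hN1⟩⟩, ?_⟩,
    hP, hPQ, hQN, hN1, hW.contDiffOn, fun α hα => ?_, hW.eq_safe, fun α hα => ?_, fun α hα => ?_,
    hrisky, fun α hα a ha => hW.prescribed hM hα ha.1
      (hW.bellman_eq_of_isBellmanOptimal hM hα ha),
    ⟨M.policy M.value W', fun α hα => hW.policy_isBellmanOptimal hM hα, fun α₀ hα₀ => ?_⟩,
    fun α₀ hα₀ P hopt => ?_⟩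
  -- Before the end of experimentation the value lies strictly above the risky line, so no earlier
  -- solution exists.
  · rintro x ⟨hx, hval⟩
    by_contra! hlt
    have h1 := hW.risky_lt hM ⟨hx.1, hlt⟩
    rw [hval, ← hform, mul_div_cancel₀ _ hM.r_pos.ne'] at h1
    exact lt_irrefl _ h1
  · exact ⟨⟨_, Market.policy_feasible hM α, hW.bellman_policy hM hα⟩, by
      rintro _ ⟨a, ha, rfl⟩
      exact hW.bellman_le hM hα ha⟩
  · exact hW.armEq hM ⟨by linarith [hα.1], by linarith [hα.2]⟩ (hM.armLoss_safe hα.2)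
  · exact hW.armEq hM ⟨by linarith [hα.1], by linarith [hα.2]⟩ (hM.armLoss_risky hα.1)
  · obtain ⟨P, hact⟩ := hW.exists_plan hM hα₀
    exact ⟨P, hact, fun Q => by
      rw [hW.profit_of_policy hM hα₀ hact]
      exact hW.profit_le hM hα₀ Q⟩
  · filter_upwards [hW.ae_bellman_eq hM hα₀ (hW.profit_eq_of_isOptimal hM hα₀ hopt)] with t ht
    exact hW.prescribed hM (P.belief_mem hα₀ t) (P.feasible t) ht
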